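/- **Setting.** Fix $1\le m_{try}\le p$ and a probability space. Let $X_0,X_1,X_2,\dots$ be iid random vectors in $\mathbb R^p$, and let $\epsilon_0,\epsilon_1,\epsilon_2,\dots$ be iid real random variables with mean $0$ and variance $\sigma^2\in(0,\infty)$, the sequence $(\epsilon_i)$ being independent of the sequence $(X_i)$. Let $m:\mathbb R^p\to\mathbb R$ be measurable, $Y_i=m(X_i)+\epsilon_i$ and $\mathcal D_n=\{(X_i,Y_i):1\le i\le n\}$; $X_0$ is an unseen input. **Random forest.** For each $n\ge1$ let $a_n\in\{1,\dots,n\}$ (subsample size) and $t_n\ge1$ (maximal number of leaves) be integers, with $\limsup_{n\to\infty}a_n/n<1$. A tree with randomness $\Theta$ is grown as follows. Draw $a_n$ of the $n$ observations uniformly without replacement. Start from the one-cell partition and visit cells level by level (first in, first out) until there are $t_n$ cells or no cell is left to visit. At each visited cell draw $m_{try}$ distinct coordinate directions in uniformly random order, independently of everything else. Among all cuts, along a drawn direction, at the midpoint of two consecutive distinct feature values of the subsampled points in the cell, perform the one maximizing the CART criterion, i.e. the decrease of the within-cell variance of the response (ties: first drawn direction, then smallest cut position). If there is no such cut, the cell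 becomes terminal. The tree prediction $m_n(x;\Theta)$ is the average response of the subsampled points lying in the same leaf as $x$. For each $n$, let $\Theta_1,\Theta_2,\dots$ be iid tree randomizations, independent of $(X_i)_{i\ge0}$ and $(\epsilon_i)_{i\ge0}$, and put $$m_{n,M}(x)=\frac1M\sum_{k=1}^M m_n(x;\Theta_k),\qquad m_{n,\infty}(x)=\lim_{M\to\infty}m_{n,M}(x).$$ For $1\le i\le n$, the out-of-bag prediction $m^{OOB}_{n,M}(X_i)$ is the average of $m_n(X_i;\Theta_k)$ over those $k\le M$ for which observation $i$ was not drawn for tree $k$ (and $0$ if there is no such $k$). **Estimators.** $$\widehat\sigma^2_{n,M}=\frac1n\sum_{i=1}^n\bigl(Y_i-m^{OOB}_{n,M}(X_i)\bigr)^2,$$ $$\widehat\sigma^2_{n,MCorrect}=\Bigl|\widehat\sigma^2_{n,M}-\frac8M\Bigl(\bigl(\max_{1\le i\le n}|m^{OOB}_{n,M}(X_i)|\bigr)^2+\widehat\sigma^2_{n,M}(1+4\log n)\Bigr)\Bigr|.$$ **Assumptions.** (A1) The support of the law of $X_0$ is $[0,1]^p$. (A2) $\sup_{x\in[0,1]^p}|m(x)|<\infty$.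 (A3) The $\epsilon_i$ are Gaussian with mean $0$ and variance $\sigma^2$. (A4) $\lim_{n\to\infty}\mathbb E[(m_{n,\infty}(X_0)-m(X_0))^2]=0$. **Claim.** Let $\lambda_1\in(0,1)$, $\lambda_2=1-\lambda_1$ and $\widehat\sigma^2_{n,M;W}=\lambda_1\widehat\sigma^2_{n,MCorrect}+\lambda_2\widehat\sigma^2_{n,M}$. Then $\widehat\sigma^2_{n,M;W}$ is $L_1$-consistent for $\sigma^2$ as $(n,M)\to\infty$ sequentially: it is integrable for all $n,M\ge1$, for every $n\ge1$ the limit $\lim_{M\to\infty}\mathbb E\,|\widehat\sigma^2_{n,M;W}-\sigma^2|$ exists in $\mathbb R$, and $$\lim_{n\to\infty}\lim_{M\to\infty}\mathbb E\bigl|\widehat\sigma^2_{n,M;W}-\sigma^2\bigr|=0 .$$ -/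

import Mathlib

open MeasureTheory ProbabilityTheory Filter Topology

noncomputable section

/-! ## Regression trees grown by the CART criterion -/

/-- A training sample: `n` pairs (feature vector, response). -/
abbrev Sample (n p : ℕ) := Fin n → (Fin p → ℝ) × ℝ

/-- The randomness of one tree: the subsample of observations the tree is grown on, and, for every
node visited while the tree is grown, an ordered draw of `mtry` distinct split directions.
(A tree grown on at most `n` points visits fewer than `2 * n` nodes.) -/
structure TreeParam (n p mtry : ℕ) where
  sample : Finset (Fin n)
  draws : Fin (2 * n) → (Fin mtry ↪ Fin p)

instance (n p mtry : ℕ) : MeasurableSpace (TreeParam n p mtry) := ⊤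

instance (n p mtry : ℕ) : DiscreteMeasurableSpace (TreeParam n p mtry) := ⟨fun _ => trivial⟩

section Cart

variable {n p mtry : ℕ} (D : Sample n p) (S : Finset (Fin n))

open Classical in
/-- Indices of the subsampled observations that lie in the cell `A`. -/
def cellPoints (A : Set (Fin p → ℝ)) : Finset (Fin n) :=
  S.filter fun i => (D i).1 ∈ A

/-- Average response over a set of observations. -/
def meanResponse (I : Finset (Fin n)) : ℝ :=
  (∑ i ∈ I, (D i).2) / (I.card : ℝ)

/-- Sum of squared deviations of the responses in the cell `A` from their average. -/
def cellSSE (A : Set (Fin p → ℝ)) : ℝ :=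
  ∑ i ∈ cellPoints D S A, ((D i).2 - meanResponse D (cellPoints D S A)) ^ 2

/-- The part of `A` to the left of the cut at `z` in direction `j`. -/
def leftCell (A : Set (Fin p → ℝ)) (j : Fin p) (z : ℝ) : Set (Fin p → ℝ) :=
  {x ∈ A | x j < z}

/-- The part of `A` to the right of the cut at `z` in direction `j`. -/
def rightCell (A : Set (Fin p → ℝ)) (j : Fin p) (z : ℝ) : Set (Fin p → ℝ) :=
  {x ∈ A | z ≤ x j}

/-- The CART regression criterion: the decrease of the within-cell variance of the response
when `A` is cut at `z` in direction `j`. -/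
def cartGain (A : Set (Fin p → ℝ)) (j : Fin p) (z : ℝ) : ℝ :=
  (cellSSE D S A - cellSSE D S (leftCell A j z) - cellSSE D S (rightCell A j z))
    / ((cellPoints D S A).card : ℝ)

/-- The distinct values of the `j`-th feature among the observations in `A`. -/
def cellValues (A : Set (Fin p → ℝ)) (j : Fin p) : Finset ℝ :=
  (cellPoints D S A).image fun i => (D i).1 j

open Classical in
/-- Admissible cut positions in direction `j`: the midpoints of consecutive distinct values. -/
def cellCuts (A : Set (Fin p → ℝ)) (j : Fin p) : Finset ℝ :=
  ((cellValues D S A j ×ˢ cellValues D S A j).filter fun v =>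
      v.1 < v.2 ∧ ∀ w ∈ cellValues D S A j, ¬ (v.1 < w ∧ w < v.2)).image
    fun v => (v.1 + v.2) / 2

open Classical in
/-- Admissible cuts `(r, z)` of `A`: at position `z` in the `r`-th drawn direction. -/
def candidateCuts (A : Set (Fin p → ℝ)) (d : Fin mtry ↪ Fin p) : Finset (Fin mtry ×ₗ ℝ) :=
  Finset.univ.biUnion fun r => (cellCuts D S A (d r)).image fun z => toLex (r, z)

open Classical in
/-- The admissible cuts of `A` that maximize the CART criterion. -/
def optimalCuts (A : Set (Fin p → ℝ)) (d : Fin mtry ↪ Fin p) : Finset (Fin mtry ×ₗ ℝ) :=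
  (candidateCuts D S A d).filter fun c =>
    ∀ c' ∈ candidateCuts D S A d,
      cartGain D S A (d (ofLex c').1) (ofLex c').2 ≤ cartGain D S A (d (ofLex c).1) (ofLex c).2

/-- The best cut of `A` along the drawn directions; ties go to the direction drawn first and then
to the smallest position. There is none if the observations in `A` agree in all drawn directions,
in particular if `A` contains a single observation. -/
def bestCut (A : Set (Fin p → ℝ)) (d : Fin mtry ↪ Fin p) : Option (Fin p × ℝ) :=
  if h : (optimalCuts D S A d).Nonempty then
    some (d (ofLex ((optimalCuts D S A d).min' h)).1, (ofLex ((optimalCuts D S A d).min' h)).2)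
  else none

end Cart

/-- State of the growing procedure: the cells still to be visited (first in, first out) and the
cells that have been declared terminal. -/
structure GrowState (p : ℕ) where
  queue : List (Set (Fin p → ℝ))
  terminal : List (Set (Fin p → ℝ))

/-- The cells of the current partition. -/
def GrowState.leaves {p : ℕ} (s : GrowState p) : List (Set (Fin p → ℝ)) :=
  s.queue ++ s.terminal

/-- Visit the next cell, unless the partition already has `T` cells or no cell is left to visit:
cut it at the best cut along the directions `d`, or declare it terminal if there is no cut. -/
def growStep {n p mtry : ℕ} (D : Sample n p) (S : Finset (Fin n)) (T : ℕ)
    (s : GrowState p) (d : Fin mtry ↪ Fin p) : GrowState p :=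
  if T ≤ s.leaves.length then s
  else
    match s.queue with
    | [] => s
    | A :: Q =>
      match bestCut D S A d with
      | none => ⟨Q, A :: s.terminal⟩
      | some (j, z) => ⟨Q ++ [leftCell A j z, rightCell A j z], s.terminal⟩

/-- The leaves of the tree with parameter `θ` and at most `T` terminal nodes, grown level by level
from the trivial partition. -/
def treeLeaves {n p mtry : ℕ} (D : Sample n p) (T : ℕ) (θ : TreeParam n p mtry) :
    List (Set (Fin p → ℝ)) :=
  ((List.ofFn θ.draws).foldl (growStep D θ.sample T) ⟨[Set.univ], []⟩).leaves

open Classical in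
/-- Prediction of one tree at `x`: the average response over those subsampled observations that
lie in the same leaf as `x`. -/
def treePredict {n p mtry : ℕ} (D : Sample n p) (T : ℕ) (θ : TreeParam n p mtry)
    (x : Fin p → ℝ) : ℝ :=
  meanResponse D (θ.sample.filter fun i => ∃ A ∈ treeLeaves D T θ, x ∈ A ∧ (D i).1 ∈ A)

/-! ## Random forests and their out-of-bag predictions -/

section Forest

variable {n p mtry : ℕ} (D : Sample n p) (T : ℕ) (θ : ℕ → TreeParam n p mtry)

/-- Prediction at `x` of the forest of the first `M` trees. -/
def forestPredict (M : ℕ) (x : Fin p → ℝ) : ℝ :=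
  (∑ k ∈ Finset.range M, treePredict D T (θ k) x) / (M : ℝ)

/-- Prediction at `x` of the infinite forest, the limit of `forestPredict` as `M → ∞`. -/
def infForestPredict (x : Fin p → ℝ) : ℝ :=
  limUnder atTop fun M : ℕ => forestPredict D T θ M x

open Classical in
/-- Those of the first `M` trees whose subsample does not contain the `i`-th observation. -/
def oobTrees (M : ℕ) (i : Fin n) : Finset ℕ :=
  (Finset.range M).filter fun k => i ∉ (θ k).sample

/-- Out-of-bag prediction at the `i`-th feature vector: the average over the trees whose subsample
does not contain the `i`-th observation (`0` if there is no such tree). -/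
def oobPredict (M : ℕ) (i : Fin n) : ℝ :=
  (∑ k ∈ oobTrees θ M i, treePredict D T (θ k) (D i).1) / ((oobTrees θ M i).card : ℝ)

/-- The residual variance estimator `(1/n) ∑ᵢ (Yᵢ - m_{n,M}^{OOB}(Xᵢ))²`. -/
def sigmaSqOOB (M : ℕ) : ℝ :=
  (∑ i : Fin n, ((D i).2 - oobPredict D T θ M i) ^ 2) / (n : ℝ)

/-- The finite-`M`-corrected residual variance estimator. -/
def sigmaSqCorrected (M : ℕ) : ℝ :=
  |sigmaSqOOB D T θ M - 8 / (M : ℝ) *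
    ((⨆ i : Fin n, |oobPredict D T θ M i|) ^ 2
      + sigmaSqOOB D T θ M * (1 + 4 * Real.log (n : ℝ)))|

/-- The weighted, finite-`M`-corrected residual variance estimator with weights `l` and `1 - l`. -/
def sigmaSqWeighted (l : ℝ) (M : ℕ) : ℝ :=
  l * sigmaSqCorrected D T θ M + (1 - l) * sigmaSqOOB D T θ M

end Forest

/-! ## The statistical model -/

section Model

variable {Ω : Type*} [MeasurableSpace Ω] {p : ℕ}

/-- The sample `(X₁, Y₁), …, (Xₙ, Yₙ)` with `Yᵢ = m (Xᵢ) + εᵢ`; index `0` is reserved for the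
unseen feature vector `X₀`. -/
def trainingData (m : (Fin p → ℝ) → ℝ) (X : ℕ → Ω → Fin p → ℝ) (ε : ℕ → Ω → ℝ) (n : ℕ)
    (ω : Ω) : Sample n p :=
  fun i => (X (i + 1) ω, m (X (i + 1) ω) + ε (i + 1) ω)

/-- The regression model: iid feature vectors `X₀, X₁, X₂, …`, a measurable regression function,
and iid errors with mean `0` and variance `σ² ∈ (0, ∞)`, independent of the features. -/
structure RegressionModel (P : Measure Ω) (m : (Fin p → ℝ) → ℝ) (X : ℕ → Ω → Fin p → ℝ)
    (ε : ℕ → Ω → ℝ) (σ : ℝ) : Prop where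
  measurable_m : Measurable m
  measurable_X : ∀ i, Measurable (X i)
  measurable_ε : ∀ i, Measurable (ε i)
  iIndep_X : iIndepFun X P
  ident_X : ∀ i, IdentDistrib (X i) (X 0) P P
  iIndep_ε : iIndepFun ε P
  ident_ε : ∀ i, IdentDistrib (ε i) (ε 0) P P
  indep_X_ε : IndepFun (fun ω i => X i ω) (fun ω i => ε i ω) P
  memLp_ε : MemLp (ε 0) 2 P
  mean_ε : ∫ ω, ε 0 ω ∂P = 0
  variance_ε : variance (ε 0) P = σ ^ 2
  sigma_pos : 0 < σ

/-- The randomness of the forests. For every sample size `n ≥ 1` the parameters of the trees are iid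
and independent of all features and errors; each consists of a subsample of size `a n`, drawn
uniformly without replacement, and of independent uniform draws of directions. -/
structure ForestRandomness (P : Measure Ω) (X : ℕ → Ω → Fin p → ℝ) (ε : ℕ → Ω → ℝ)
    {mtry : ℕ} (a : ℕ → ℕ) (Θ : ∀ n : ℕ, ℕ → Ω → TreeParam n p mtry) : Prop where
  law : ∀ n, 1 ≤ n → ∀ k, HasLaw (Θ n k)
    (uniformOn {θ : TreeParam n p mtry | θ.sample.card = a n}) P
  iIndep : ∀ n, 1 ≤ n → iIndepFun (Θ n) P
  indep_data : ∀ n, 1 ≤ n →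
    IndepFun (fun ω k => Θ n k ω) (fun ω => (fun i => X i ω, fun i => ε i ω)) P

end Model

end

noncomputable section

/-! ## Invariance of trees under relabelling of the observations -/

section Relabelling

variable {n p mtry : ℕ} {D D' : Sample n p} {S S' : Finset (Fin n)} {A A' : Set (Fin p → ℝ)}
  {φ : Fin n ↪ Fin n}

theorem mem_cellPoints {i : Fin n} : i ∈ cellPoints D S A ↔ i ∈ S ∧ (D i).1 ∈ A := by
  simp [cellPoints]

theorem cellPoints_leftCell (j : Fin p) (z : ℝ) :
    cellPoints D S (leftCell A j z) = (cellPoints D S A).filter fun i => (D i).1 j < z := by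
  ext i
  simp only [mem_cellPoints, leftCell, Finset.mem_filter, Set.mem_ofPred_eq, and_assoc]

theorem cellPoints_rightCell (j : Fin p) (z : ℝ) :
    cellPoints D S (rightCell A j z) = (cellPoints D S A).filter fun i => z ≤ (D i).1 j := by
  ext i
  simp only [mem_cellPoints, rightCell, Finset.mem_filter, Set.mem_ofPred_eq, and_assoc]

theorem meanResponse_map {I : Finset (Fin n)} (hD : ∀ i ∈ I, D' (φ i) = D i) :
    meanResponse D' (I.map φ) = meanResponse D I := by
  rw [meanResponse, meanResponse, Finset.sum_map, Finset.card_map]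
  congr 1
  exact Finset.sum_congr rfl fun i hi => by rw [hD i hi]

theorem cellSSE_congr (hC : cellPoints D' S' A' = (cellPoints D S A).map φ)
    (hD : ∀ i ∈ cellPoints D S A, D' (φ i) = D i) : cellSSE D' S' A' = cellSSE D S A := by
  rw [cellSSE, cellSSE, hC, Finset.sum_map, meanResponse_map hD]
  exact Finset.sum_congr rfl fun i hi => by rw [hD i hi]

theorem filter_map_relabel {I : Finset (Fin n)} (hD : ∀ i ∈ I, D' (φ i) = D i)
    (q : (Fin p → ℝ) → Prop) [DecidablePred q] :
    (I.map φ).filter (fun i => q (D' i).1) = (I.filter fun i => q (D i).1).map φ := by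
  ext i
  simp only [Finset.mem_filter, Finset.mem_map]
  constructor
  · rintro ⟨⟨k, hk, rfl⟩, hq⟩
    exact ⟨k, ⟨hk, by rwa [← hD k hk]⟩, rfl⟩
  · rintro ⟨k, ⟨hk, hq⟩, rfl⟩
    exact ⟨⟨k, hk, rfl⟩, by rwa [hD k hk]⟩

theorem cartGain_congr (hC : cellPoints D' S' A' = (cellPoints D S A).map φ)
    (hD : ∀ i ∈ cellPoints D S A, D' (φ i) = D i) (j : Fin p) (z : ℝ) :
    cartGain D' S' A' j z = cartGain D S A j z := by
  have hl : cellSSE D' S' (leftCell A' j z) = cellSSE D S (leftCell A j z) := by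
    refine cellSSE_congr (φ := φ) ?_ fun i hi => ?_
    · rw [cellPoints_leftCell, cellPoints_leftCell, hC]
      exact filter_map_relabel hD fun x => x j < z
    · rw [cellPoints_leftCell] at hi
      exact hD i (Finset.mem_filter.1 hi).1
  have hr : cellSSE D' S' (rightCell A' j z) = cellSSE D S (rightCell A j z) := by
    refine cellSSE_congr (φ := φ) ?_ fun i hi => ?_
    · rw [cellPoints_rightCell, cellPoints_rightCell, hC]
      exact filter_map_relabel hD fun x => z ≤ x j
    · rw [cellPoints_rightCell] at hi
      exact hD i (Finset.mem_filter.1 hi).1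
  rw [cartGain, cartGain, hl, hr, cellSSE_congr hC hD, hC, Finset.card_map]

theorem cellValues_congr (hC : cellPoints D' S' A' = (cellPoints D S A).map φ)
    (hD : ∀ i ∈ cellPoints D S A, D' (φ i) = D i) (j : Fin p) :
    cellValues D' S' A' j = cellValues D S A j := by
  rw [cellValues, cellValues, hC, Finset.map_eq_image, Finset.image_image]
  refine Finset.image_congr fun i hi => ?_
  simp [hD i hi]

theorem candidateCuts_congr (hC : cellPoints D' S' A' = (cellPoints D S A).map φ)
    (hD : ∀ i ∈ cellPoints D S A, D' (φ i) = D i) (d : Fin mtry ↪ Fin p) :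
    candidateCuts D' S' A' d = candidateCuts D S A d := by
  simp only [candidateCuts, cellCuts, cellValues_congr hC hD]

theorem optimalCuts_congr (hC : cellPoints D' S' A' = (cellPoints D S A).map φ)
    (hD : ∀ i ∈ cellPoints D S A, D' (φ i) = D i) (d : Fin mtry ↪ Fin p) :
    optimalCuts D' S' A' d = optimalCuts D S A d := by
  simp only [optimalCuts, candidateCuts_congr hC hD, cartGain_congr hC hD]

theorem bestCut_congr (hC : cellPoints D' S' A' = (cellPoints D S A).map φ)
    (hD : ∀ i ∈ cellPoints D S A, D' (φ i) = D i) (d : Fin mtry ↪ Fin p) :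
    bestCut D' S' A' d = bestCut D S A d := by
  simp only [bestCut, optimalCuts_congr hC hD]

theorem bestCut_eq_cellPoints (D : Sample n p) (S : Finset (Fin n)) (A : Set (Fin p → ℝ))
    (d : Fin mtry ↪ Fin p) : bestCut D S A d = bestCut D (cellPoints D S A) Set.univ d := by
  have h : cellPoints D (cellPoints D S A) Set.univ = cellPoints D S A := by
    ext i; simp [mem_cellPoints]
  refine bestCut_congr (D := D) (D' := D) (φ := Function.Embedding.refl _) ?_ (fun _ _ => rfl) d
  rw [h, Finset.map_refl]

theorem growStep_map (hD : ∀ i ∈ S, D' (φ i) = D i) (T : ℕ) (s : GrowState p)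
    (d : Fin mtry ↪ Fin p) : growStep D' (S.map φ) T s d = growStep D S T s d := by
  have hC (A : Set (Fin p → ℝ)) : cellPoints D' (S.map φ) A = (cellPoints D S A).map φ := by
    classical exact filter_map_relabel hD fun x => x ∈ A
  have hb (A : Set (Fin p → ℝ)) : bestCut D' (S.map φ) A d = bestCut D S A d :=
    bestCut_congr (hC A) (fun i hi => hD i (mem_cellPoints.1 hi).1) d
  simp only [growStep, hb]

theorem treeLeaves_map (hD : ∀ i ∈ S, D' (φ i) = D i) (T : ℕ)
    (e : Fin (2 * n) → (Fin mtry ↪ Fin p)) :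
    treeLeaves D' T ⟨S.map φ, e⟩ = treeLeaves D T ⟨S, e⟩ := by
  have h : growStep (mtry := mtry) D' (S.map φ) T = growStep D S T := by
    funext s d; exact growStep_map hD T s d
  simp only [treeLeaves, h]

/-- A tree depends on its subsample only through the multiset of observations it consists of. -/
theorem treePredict_map (hD : ∀ i ∈ S, D' (φ i) = D i) (T : ℕ)
    (e : Fin (2 * n) → (Fin mtry ↪ Fin p)) (x : Fin p → ℝ) :
    treePredict D' T ⟨S.map φ, e⟩ x = treePredict D T ⟨S, e⟩ x := by
  classical
  simp only [treePredict, treeLeaves_map hD]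
  have h := filter_map_relabel hD
    fun y => ∃ A ∈ treeLeaves D T ⟨S, e⟩, x ∈ A ∧ y ∈ A
  have h' := meanResponse_map (D := D) (D' := D') (φ := φ)
    (I := S.filter fun i => ∃ A ∈ treeLeaves D T ⟨S, e⟩, x ∈ A ∧ (D i).1 ∈ A)
    fun i hi => hD i (Finset.mem_filter.1 hi).1
  rw [← h] at h'
  convert h' using 2

theorem treePredict_congr (hD : ∀ i ∈ S, D' i = D i) (T : ℕ)
    (e : Fin (2 * n) → (Fin mtry ↪ Fin p)) (x : Fin p → ℝ) :
    treePredict D' T ⟨S, e⟩ x = treePredict D T ⟨S, e⟩ x := by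
  simpa using treePredict_map (φ := Function.Embedding.refl _) hD T e x

end Relabelling

/-- The sum of the absolute responses. -/
def absResponseSum {n p : ℕ} (D : Sample n p) : ℝ := ∑ i, |(D i).2|

section Bounds

variable {n p mtry : ℕ} (D : Sample n p)

theorem absResponseSum_nonneg : 0 ≤ absResponseSum D := Finset.sum_nonneg fun _ _ => abs_nonneg _

theorem abs_response_le (i : Fin n) : |(D i).2| ≤ absResponseSum D :=
  Finset.single_le_sum (f := fun i => |(D i).2|) (fun _ _ => abs_nonneg _) (Finset.mem_univ i)

theorem abs_sum_div_card_le {ι : Type*} (s : Finset ι) (f : ι → ℝ) {B : ℝ} (hB : 0 ≤ B)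
    (h : ∀ i ∈ s, |f i| ≤ B) : |(∑ i ∈ s, f i) / (s.card : ℝ)| ≤ B := by
  rcases s.eq_empty_or_nonempty with rfl | hs
  · simpa using hB
  · have hc : (0 : ℝ) < s.card := by exact_mod_cast hs.card_pos
    rw [abs_div, abs_of_pos hc, div_le_iff₀ hc]
    calc |∑ i ∈ s, f i| ≤ ∑ i ∈ s, |f i| := Finset.abs_sum_le_sum_abs _ _
      _ ≤ ∑ _i ∈ s, B := Finset.sum_le_sum h
      _ = B * s.card := by rw [Finset.sum_const, nsmul_eq_mul, mul_comm]

theorem abs_treePredict_le (T : ℕ) (θ : TreeParam n p mtry) (x : Fin p → ℝ) :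
    |treePredict D T θ x| ≤ absResponseSum D :=
  abs_sum_div_card_le _ _ (absResponseSum_nonneg D) fun i _ => abs_response_le D i

variable (T : ℕ) (θ : ℕ → TreeParam n p mtry) (M : ℕ)

theorem abs_oobPredict_le (i : Fin n) : |oobPredict D T θ M i| ≤ absResponseSum D :=
  abs_sum_div_card_le _ _ (absResponseSum_nonneg D) fun _ _ => abs_treePredict_le D T _ _

theorem sigmaSqOOB_nonneg : 0 ≤ sigmaSqOOB D T θ M :=
  div_nonneg (Finset.sum_nonneg fun _ _ => sq_nonneg _) (Nat.cast_nonneg _)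

theorem sq_residual_le (i : Fin n) {y : ℝ} (hy : |y| ≤ absResponseSum D) :
    ((D i).2 - y) ^ 2 ≤ 4 * absResponseSum D ^ 2 := by
  have h : |(D i).2 - y| ≤ 2 * absResponseSum D := by
    linarith [abs_sub (D i).2 y, abs_response_le D i]
  calc ((D i).2 - y) ^ 2 = |(D i).2 - y| ^ 2 := (sq_abs _).symm
    _ ≤ (2 * absResponseSum D) ^ 2 := by gcongr
    _ = _ := by ring

theorem sigmaSqOOB_le : sigmaSqOOB D T θ M ≤ 4 * absResponseSum D ^ 2 := by
  have h := abs_sum_div_card_le (Finset.univ : Finset (Fin n))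
    (fun i => ((D i).2 - oobPredict D T θ M i) ^ 2) (B := 4 * absResponseSum D ^ 2) (by positivity)
    fun i _ => by
      rw [abs_of_nonneg (sq_nonneg _)]
      exact sq_residual_le D i (abs_oobPredict_le D T θ M i)
  rw [Finset.card_univ, Fintype.card_fin] at h
  exact (le_abs_self _).trans h

theorem iSup_abs_oobPredict_nonneg : 0 ≤ ⨆ i : Fin n, |oobPredict D T θ M i| :=
  Real.iSup_nonneg fun _ => abs_nonneg _

theorem iSup_abs_oobPredict_le : ⨆ i : Fin n, |oobPredict D T θ M i| ≤ absResponseSum D :=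
  Real.iSup_le (abs_oobPredict_le D T θ M) (absResponseSum_nonneg D)

theorem abs_correction_le :
    |(⨆ i : Fin n, |oobPredict D T θ M i|) ^ 2
      + sigmaSqOOB D T θ M * (1 + 4 * Real.log (n : ℝ))| ≤
    (5 + 16 * Real.log n) * absResponseSum D ^ 2 := by
  have hlog : 0 ≤ Real.log (n : ℝ) := Real.log_natCast_nonneg n
  have h1 := iSup_abs_oobPredict_nonneg D T θ M
  have h2 := iSup_abs_oobPredict_le D T θ M
  have h3 := sigmaSqOOB_nonneg D T θ M
  have h4 := sigmaSqOOB_le D T θ M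
  have h5 : (⨆ i : Fin n, |oobPredict D T θ M i|) ^ 2 ≤ absResponseSum D ^ 2 := by gcongr
  have h6 : sigmaSqOOB D T θ M * (1 + 4 * Real.log (n : ℝ)) ≤
      4 * absResponseSum D ^ 2 * (1 + 4 * Real.log (n : ℝ)) := by gcongr
  rw [abs_of_nonneg (by positivity)]
  linarith

theorem abs_sigmaSqWeighted_le {l : ℝ} (hl : l ∈ Set.Ioo (0 : ℝ) 1) :
    |sigmaSqWeighted D T θ l M| ≤ (44 + 128 * Real.log n) * absResponseSum D ^ 2 := by
  have hlog : 0 ≤ Real.log (n : ℝ) := Real.log_natCast_nonneg n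
  have h3 := sigmaSqOOB_nonneg D T θ M
  have h4 := sigmaSqOOB_le D T θ M
  have hM : |8 / (M : ℝ)| ≤ 8 := by
    rw [abs_of_nonneg (by positivity)]
    rcases Nat.eq_zero_or_pos M with rfl | hM
    · simp
    · exact div_le_self (by norm_num) (by exact_mod_cast hM)
  have hc : sigmaSqCorrected D T θ M ≤
      4 * absResponseSum D ^ 2 + 8 * ((5 + 16 * Real.log n) * absResponseSum D ^ 2) := by
    refine (abs_sub _ _).trans (add_le_add ?_ ?_)
    · rwa [abs_of_nonneg h3]
    · rw [abs_mul]
      gcongr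
      exact abs_correction_le D T θ M
  have hc0 : 0 ≤ sigmaSqCorrected D T θ M := abs_nonneg _
  obtain ⟨hl0, hl1⟩ := hl
  have hB : 0 ≤ absResponseSum D ^ 2 := sq_nonneg _
  rw [sigmaSqWeighted, abs_of_nonneg (add_nonneg (mul_nonneg hl0.le hc0) (mul_nonneg (by linarith) h3))]
  have h7 : sigmaSqOOB D T θ M ≤ (44 + 128 * Real.log n) * absResponseSum D ^ 2 := by
    nlinarith [mul_nonneg hlog hB]
  have h8 : sigmaSqCorrected D T θ M ≤ (44 + 128 * Real.log n) * absResponseSum D ^ 2 := by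
    nlinarith
  nlinarith

end Bounds

/-! ## Measurability of trees -/

section Measurability

variable {α : Type*} [MeasurableSpace α]

theorem measurable_countable_index {ι β : Type*} [Countable ι] {mβ : MeasurableSpace β}
    {f : α → ι} {g : ι → α → β} (hf : Measurable[_, ⊤] f) (hg : ∀ t, Measurable (g t)) :
    Measurable fun q => g (f q) q := by
  intro s hs
  have h : (fun q => g (f q) q) ⁻¹' s = ⋃ t, (f ⁻¹' {t} ∩ g t ⁻¹' s) := by
    ext q; simp
  rw [h]
  exact MeasurableSet.iUnion fun t => (hf trivial).inter (hg t hs)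

theorem measurable_top_of_fibers {ι : Type*} [Countable ι] {f : α → ι}
    (hf : ∀ t, MeasurableSet {q | f q = t}) : Measurable[_, ⊤] f := by
  intro s _
  have h : f ⁻¹' s = ⋃ t ∈ s, {q | f q = t} := by
    ext q; simp
  rw [h]
  exact MeasurableSet.biUnion (Set.to_countable s) fun t _ => hf t

theorem measurableSet_forall {ι : Type*} [Countable ι] {P : ι → α → Prop}
    (h : ∀ i, MeasurableSet {q | P i q}) : MeasurableSet {q | ∀ i, P i q} := by
  rw [Set.ofPred_forall]
  exact MeasurableSet.iInter h

theorem measurableSet_exists {ι : Type*} [Countable ι] {P : ι → α → Prop}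
    (h : ∀ i, MeasurableSet {q | P i q}) : MeasurableSet {q | ∃ i, P i q} := by
  rw [Set.ofPred_exists]
  exact MeasurableSet.iUnion h

theorem measurable_finset_of_mem {ι : Type*} [Finite ι] {F : α → Finset ι}
    (hF : ∀ i, MeasurableSet {q | i ∈ F q}) : Measurable[_, ⊤] F := by
  refine measurable_top_of_fibers fun J => ?_
  have h : {q | F q = J} = {q | ∀ i, i ∈ F q ↔ i ∈ J} := by
    ext q; simp [Finset.ext_iff]
  rw [h]
  exact measurableSet_forall fun i => (hF i).iff (MeasurableSet.const _)

theorem measurable_set_of_mem {ι : Type*} [Finite ι] {F : α → Set ι}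
    (hF : ∀ i, MeasurableSet {q | i ∈ F q}) : Measurable[_, ⊤] F := by
  refine measurable_top_of_fibers fun J => ?_
  have h : {q | F q = J} = {q | ∀ i, i ∈ F q ↔ i ∈ J} := by
    ext q; simp [Set.ext_iff]
  rw [h]
  exact measurableSet_forall fun i => (hF i).iff (MeasurableSet.const _)

variable {n p mtry : ℕ} {D : α → Sample n p} {z : α → ℝ}

theorem measurable_feature (hD : Measurable D) (i : Fin n) (j : Fin p) :
    Measurable fun q => (D q i).1 j := by fun_prop

theorem measurable_response (hD : Measurable D) (i : Fin n) : Measurable fun q => (D q i).2 := by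
  fun_prop

theorem measurable_meanResponse (hD : Measurable D) (I : Finset (Fin n)) :
    Measurable fun q => meanResponse (D q) I := by
  simp only [meanResponse]
  exact (Finset.measurable_sum _ fun i _ => measurable_response hD i).div_const _

theorem measurable_cellSSE (hD : Measurable D) {I : Finset (Fin n)} {A : α → Set (Fin p → ℝ)}
    (hA : ∀ i, MeasurableSet {q | (D q i).1 ∈ A q}) :
    Measurable fun q => cellSSE (D q) I (A q) := by
  have hC : Measurable[_, ⊤] fun q => cellPoints (D q) I (A q) := by
    refine measurable_finset_of_mem fun i => ?_
    simp only [mem_cellPoints]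
    exact (MeasurableSet.const _).inter (hA i)
  simp only [cellSSE]
  exact measurable_countable_index
    (g := fun J q => ∑ i ∈ J, ((D q i).2 - meanResponse (D q) J) ^ 2) hC fun J =>
    Finset.measurable_sum _ fun i _ =>
      ((measurable_response hD i).sub (measurable_meanResponse hD J)).pow_const 2

theorem measurable_cartGain (hD : Measurable D) (hz : Measurable z) (I : Finset (Fin n))
    (j : Fin p) : Measurable fun q => cartGain (D q) I Set.univ j (z q) := by
  have h0 : ∀ q, cellPoints (D q) I Set.univ = I := fun q => by ext; simp [mem_cellPoints]
  simp only [cartGain, h0]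
  refine Measurable.div_const (((measurable_cellSSE hD ?_).sub (measurable_cellSSE hD ?_)).sub
    (measurable_cellSSE hD ?_)) _
  · simp
  · intro i
    simpa [leftCell] using measurableSet_lt (measurable_feature hD i j) hz
  · intro i
    simpa [rightCell] using measurableSet_le hz (measurable_feature hD i j)

/-- The midpoint of the `j`-th features of two observations. -/
def midpointCut (D : Sample n p) (j : Fin p) (i k : Fin n) : ℝ := ((D i).1 j + (D k).1 j) / 2

theorem measurable_midpointCut (hD : Measurable D) (j : Fin p) (i k : Fin n) :
    Measurable fun q => midpointCut (D q) j i k := by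
  simp only [midpointCut]
  exact ((measurable_feature hD i j).add (measurable_feature hD k j)).div_const 2

theorem mem_cellCuts {D : Sample n p} {I : Finset (Fin n)} {j : Fin p} {z : ℝ} :
    z ∈ cellCuts D I Set.univ j ↔
      ∃ i k, (i ∈ I ∧ k ∈ I ∧ (D i).1 j < (D k).1 j ∧
        ∀ h, h ∈ I → ¬ ((D i).1 j < (D h).1 j ∧ (D h).1 j < (D k).1 j)) ∧
        midpointCut D j i k = z := by
  have hv : ∀ v, v ∈ cellValues D I Set.univ j ↔ ∃ i, i ∈ I ∧ (D i).1 j = v := fun v => by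
    simp [cellValues, mem_cellPoints]
  rw [cellCuts]
  simp only [Finset.mem_image, Finset.mem_filter, Finset.mem_product, hv]
  constructor
  · rintro ⟨⟨v, w⟩, ⟨⟨⟨i, hi, hiv⟩, k, hk, hkw⟩, hlt, hno⟩, rfl⟩
    dsimp only at hiv hkw hlt hno
    subst hiv hkw
    exact ⟨i, k, ⟨hi, hk, hlt, fun h hh => hno _ ⟨h, hh, rfl⟩⟩, rfl⟩
  · rintro ⟨i, k, ⟨hi, hk, hlt, hno⟩, rfl⟩
    refine ⟨((D i).1 j, (D k).1 j), ⟨⟨⟨i, hi, rfl⟩, k, hk, rfl⟩, hlt, ?_⟩, rfl⟩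
    rintro w ⟨h, hh, rfl⟩
    exact hno h hh

theorem mem_candidateCuts {D : Sample n p} {I : Finset (Fin n)} {d : Fin mtry ↪ Fin p}
    {r : Fin mtry} {z : ℝ} :
    toLex (r, z) ∈ candidateCuts D I Set.univ d ↔ z ∈ cellCuts D I Set.univ (d r) := by
  rw [candidateCuts]
  simp only [Finset.mem_biUnion, Finset.mem_univ, true_and, Finset.mem_image]
  constructor
  · rintro ⟨r', z', hz', h⟩
    obtain ⟨rfl, rfl⟩ : r' = r ∧ z' = z := by simpa using h
    exact hz'
  · exact fun h => ⟨r, z, h, rfl⟩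

theorem exists_eq_midpointCut {D : Sample n p} {I : Finset (Fin n)} {d : Fin mtry ↪ Fin p}
    {c : Fin mtry ×ₗ ℝ} (hc : c ∈ candidateCuts D I Set.univ d) :
    ∃ r i k, c = toLex (r, midpointCut D (d r) i k) := by
  obtain ⟨⟨r, z⟩, rfl⟩ := toLex.surjective c
  obtain ⟨i, k, -, rfl⟩ := mem_cellCuts.1 (mem_candidateCuts.1 hc)
  exact ⟨r, i, k, rfl⟩

theorem measurableSet_mem_candidateCuts (hD : Measurable D) (hz : Measurable z)
    (I : Finset (Fin n)) (d : Fin mtry ↪ Fin p) (r : Fin mtry) :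
    MeasurableSet {q | toLex (r, z q) ∈ candidateCuts (D q) I Set.univ d} := by
  simp only [mem_candidateCuts, mem_cellCuts]
  refine measurableSet_exists fun i => measurableSet_exists fun k => MeasurableSet.inter
    ((MeasurableSet.const _).inter ((MeasurableSet.const _).inter
      ((measurableSet_lt (measurable_feature hD i _) (measurable_feature hD k _)).inter
        (measurableSet_forall fun h => (MeasurableSet.const _).imp (MeasurableSet.compl
          ((measurableSet_lt (measurable_feature hD i _) (measurable_feature hD h _)).inter
            (measurableSet_lt (measurable_feature hD h _) (measurable_feature hD k _))))))))
    (measurableSet_eq_fun (measurable_midpointCut hD _ i k) hz)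

theorem mem_optimalCuts {D : Sample n p} {I : Finset (Fin n)} {d : Fin mtry ↪ Fin p}
    {r : Fin mtry} {z : ℝ} :
    toLex (r, z) ∈ optimalCuts D I Set.univ d ↔
      toLex (r, z) ∈ candidateCuts D I Set.univ d ∧
        ∀ r' i k, toLex (r', midpointCut D (d r') i k) ∈ candidateCuts D I Set.univ d →
          cartGain D I Set.univ (d r') (midpointCut D (d r') i k) ≤
            cartGain D I Set.univ (d r) z := by
  rw [optimalCuts, Finset.mem_filter]
  refine and_congr_right fun _ => ⟨fun h r' i k hc => ?_, fun h c hc => ?_⟩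
  · have := h (toLex (r', midpointCut D (d r') i k)) hc
    simpa only [ofLex_toLex] using this
  obtain ⟨r', i, k, rfl⟩ := exists_eq_midpointCut hc
  simpa only [ofLex_toLex] using h r' i k hc

theorem measurableSet_mem_optimalCuts (hD : Measurable D) (hz : Measurable z)
    (I : Finset (Fin n)) (d : Fin mtry ↪ Fin p) (r : Fin mtry) :
    MeasurableSet {q | toLex (r, z q) ∈ optimalCuts (D q) I Set.univ d} := by
  simp only [mem_optimalCuts]
  exact (measurableSet_mem_candidateCuts hD hz I d r).inter
    (measurableSet_forall fun r' => measurableSet_forall fun i => measurableSet_forall fun k =>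
      (measurableSet_mem_candidateCuts hD (measurable_midpointCut hD _ i k) I d r').imp
        (measurableSet_le (measurable_cartGain hD (measurable_midpointCut hD _ i k) I _)
          (measurable_cartGain hD hz I _)))

theorem bestCut_eq_some_iff {D : Sample n p} {I : Finset (Fin n)} {d : Fin mtry ↪ Fin p}
    {j : Fin p} {z : ℝ} :
    bestCut D I Set.univ d = some (j, z) ↔
      ∃ r, d r = j ∧ toLex (r, z) ∈ optimalCuts D I Set.univ d ∧
        ∀ r' i k, toLex (r', midpointCut D (d r') i k) ∈ optimalCuts D I Set.univ d →
          (r < r' ∨ r = r' ∧ z ≤ midpointCut D (d r') i k) := by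
  have hle (r r' : Fin mtry) (z z' : ℝ) :
      toLex (r, z) ≤ toLex (r', z') ↔ r < r' ∨ r = r' ∧ z ≤ z' := by
    rw [Prod.Lex.le_iff]; rfl
  unfold bestCut
  split_ifs with hne
  · rw [Option.some_inj, Prod.mk.injEq]
    set c := (optimalCuts D I Set.univ d).min' hne with hc
    have hcm : c ∈ optimalCuts D I Set.univ d := Finset.min'_mem _ _
    constructor
    · rintro ⟨rfl, rfl⟩
      refine ⟨(ofLex c).1, rfl, hcm, fun r' i k h => ?_⟩
      rw [← hle]
      exact Finset.min'_le _ _ h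
    · rintro ⟨r, rfl, hm, hmin⟩
      have h1 : c ≤ toLex (r, z) := Finset.min'_le _ _ hm
      have h2 : toLex (r, z) ≤ c := by
        obtain ⟨r', i, k, hrc⟩ := exists_eq_midpointCut (Finset.mem_filter.1 hcm).1
        rw [hrc, hle]
        exact hmin r' i k (hrc ▸ hcm)
      rw [le_antisymm h1 h2]
      exact ⟨rfl, rfl⟩
  · simp only [false_iff]
    rintro ⟨r, -, hm, -⟩
    exact hne ⟨_, hm⟩

theorem measurableSet_bestCut_eq_some (hD : Measurable D) (hz : Measurable z)
    (I : Finset (Fin n)) (d : Fin mtry ↪ Fin p) (j : Fin p) :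
    MeasurableSet {q | bestCut (D q) I Set.univ d = some (j, z q)} := by
  simp only [bestCut_eq_some_iff]
  refine measurableSet_exists fun r => (MeasurableSet.const _).inter
    ((measurableSet_mem_optimalCuts hD hz I d r).inter
      (measurableSet_forall fun r' => measurableSet_forall fun i => measurableSet_forall fun k =>
        (measurableSet_mem_optimalCuts hD (measurable_midpointCut hD _ i k) I d r').imp
          ((MeasurableSet.const _).union ((MeasurableSet.const _).inter
            (measurableSet_le hz (measurable_midpointCut hD _ i k))))))

theorem bestCut_eq_midpointCut {D : Sample n p} {I : Finset (Fin n)} {d : Fin mtry ↪ Fin p}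
    {c : Fin p × ℝ} (h : bestCut D I Set.univ d = some c) :
    ∃ i k, bestCut D I Set.univ d = some (c.1, midpointCut D c.1 i k) := by
  obtain ⟨j, z⟩ := c
  obtain ⟨r, rfl, hm, -⟩ := bestCut_eq_some_iff.1 h
  obtain ⟨i, k, -, rfl⟩ := mem_cellCuts.1 (mem_candidateCuts.1 (Finset.mem_filter.1 hm).1)
  exact ⟨i, k, h⟩

/-- A function of the best cut of a fixed set of observations is measurable if it is measurable
at every possible cut. -/
theorem measurable_bestCut_comp {β : Type*} {mβ : MeasurableSpace β} (hD : Measurable D)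
    (I : Finset (Fin n)) (d : Fin mtry ↪ Fin p) {g : α → Option (Fin p × ℝ) → β}
    (hnone : Measurable fun q => g q none)
    (hsome : ∀ j i k, Measurable fun q => g q (some (j, midpointCut (D q) j i k))) :
    Measurable fun q => g q (bestCut (D q) I Set.univ d) := by
  intro s hs
  have hE (j i k) : MeasurableSet
      {q | bestCut (D q) I Set.univ d = some (j, midpointCut (D q) j i k)} :=
    measurableSet_bestCut_eq_some hD (measurable_midpointCut hD j i k) I d j
  have h : (fun q => g q (bestCut (D q) I Set.univ d)) ⁻¹' s =
      ((⋃ j, ⋃ i, ⋃ k, {q | bestCut (D q) I Set.univ d = some (j, midpointCut (D q) j i k)})ᶜ ∩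
        (fun q => g q none) ⁻¹' s) ∪
      ⋃ j, ⋃ i, ⋃ k, ({q | bestCut (D q) I Set.univ d = some (j, midpointCut (D q) j i k)} ∩
        (fun q => g q (some (j, midpointCut (D q) j i k))) ⁻¹' s) := by
    ext q
    simp only [Set.mem_preimage, Set.mem_union, Set.mem_inter_iff, Set.mem_compl_iff,
      Set.mem_iUnion, Set.mem_ofPred_eq]
    constructor
    · intro hq
      rcases hb : bestCut (D q) I Set.univ d with _ | c
      · left
        rw [hb] at hq
        exact ⟨by simp, hq⟩
      · right
        obtain ⟨i, k, h⟩ := bestCut_eq_midpointCut hb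
        rw [h] at hq
        exact ⟨c.1, i, k, hb.symm.trans h, hq⟩
    · rintro (⟨hno, hq⟩ | ⟨j, i, k, hb, hq⟩)
      · rcases hb : bestCut (D q) I Set.univ d with _ | c
        · exact hq
        · obtain ⟨i, k, h⟩ := bestCut_eq_midpointCut hb
          exact absurd ⟨c.1, i, k, h⟩ hno
      · rw [hb]; exact hq
  rw [h]
  exact ((MeasurableSet.iUnion fun j => MeasurableSet.iUnion fun i => MeasurableSet.iUnion fun k =>
    hE j i k).compl.inter (hnone hs)).union (MeasurableSet.iUnion fun j => MeasurableSet.iUnion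
      fun i => MeasurableSet.iUnion fun k => (hE j i k).inter (hsome j i k hs))

end Measurability

section Traces

variable {n p mtry : ℕ}

/-- The feature vectors of the sample, together with one further point `x`. -/
def tracePoint (D : Sample n p) (x : Fin p → ℝ) (o : Option (Fin n)) : Fin p → ℝ :=
  o.elim x fun i => (D i).1

/-- The trace of a cell on the feature vectors of the sample and the point `x`. -/
def cellTrace (D : Sample n p) (x : Fin p → ℝ) (A : Set (Fin p → ℝ)) : Set (Option (Fin n)) :=
  {o | tracePoint D x o ∈ A}

/-- The traces of the cells of a growing tree. -/
abbrev TraceState (n : ℕ) := List (Set (Option (Fin n))) × List (Set (Option (Fin n)))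

def stateTrace (D : Sample n p) (x : Fin p → ℝ) (s : GrowState p) : TraceState n :=
  (s.queue.map (cellTrace D x), s.terminal.map (cellTrace D x))

open Classical in
/-- The observations of the subsample in a cell with trace `B`. -/
def tracePoints (S : Finset (Fin n)) (B : Set (Option (Fin n))) : Finset (Fin n) :=
  S.filter fun i => some i ∈ B

/-- The effect of a cut, if there is one, on the first of the traces `B :: Q`. -/
def traceCut (D : Sample n p) (x : Fin p → ℝ) (B : Set (Option (Fin n)))
    (Q U : List (Set (Option (Fin n)))) : Option (Fin p × ℝ) → TraceState n
  | none => (Q, B :: U)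
  | some (j, z) =>
    (Q ++ [{o | o ∈ B ∧ tracePoint D x o j < z}, {o | o ∈ B ∧ z ≤ tracePoint D x o j}], U)

/-- The growing procedure on the level of traces. -/
def traceStep (D : Sample n p) (x : Fin p → ℝ) (S : Finset (Fin n)) (T : ℕ)
    (d : Fin mtry ↪ Fin p) (t : TraceState n) : TraceState n :=
  if T ≤ (t.1 ++ t.2).length then t
  else
    match t.1 with
    | [] => t
    | B :: Q => traceCut D x B Q t.2 (bestCut D (tracePoints S B) Set.univ d)

theorem tracePoints_cellTrace (D : Sample n p) (x : Fin p → ℝ) (S : Finset (Fin n))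
    (A : Set (Fin p → ℝ)) : tracePoints S (cellTrace D x A) = cellPoints D S A := by
  ext i
  classical
  rw [mem_cellPoints]
  simp only [tracePoints, Finset.mem_filter]
  rfl

theorem stateTrace_growStep (D : Sample n p) (x : Fin p → ℝ) (S : Finset (Fin n)) (T : ℕ)
    (d : Fin mtry ↪ Fin p) (s : GrowState p) :
    stateTrace D x (growStep D S T s d) = traceStep D x S T d (stateTrace D x s) := by
  obtain ⟨Q, U⟩ := s
  have hlen : ((stateTrace D x ⟨Q, U⟩).1 ++ (stateTrace D x ⟨Q, U⟩).2).length =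
      (GrowState.leaves ⟨Q, U⟩).length := by
    simp [stateTrace, GrowState.leaves]
  unfold growStep traceStep
  rw [hlen]
  split_ifs with hT
  · rfl
  · cases Q with
    | nil => rfl
    | cons A Q =>
      simp only [stateTrace, List.map_cons, tracePoints_cellTrace, ← bestCut_eq_cellPoints]
      cases bestCut D S A d with
      | none => rfl
      | some c =>
        obtain ⟨j, z⟩ := c
        simp only [traceCut, List.map_append, List.map_cons, List.map_nil]
        rfl

theorem stateTrace_foldl (D : Sample n p) (x : Fin p → ℝ) (S : Finset (Fin n)) (T : ℕ)
    (ds : List (Fin mtry ↪ Fin p)) (s : GrowState p) :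
    stateTrace D x (ds.foldl (growStep D S T) s) =
      ds.foldl (fun t d => traceStep D x S T d t) (stateTrace D x s) := by
  induction ds generalizing s with
  | nil => rfl
  | cons d ds ih => rw [List.foldl_cons, List.foldl_cons, ih, stateTrace_growStep]

variable {α : Type*} [MeasurableSpace α] {D : α → Sample n p} {x : α → Fin p → ℝ}

theorem measurable_tracePoint (hD : Measurable D) (hx : Measurable x) (o : Option (Fin n))
    (j : Fin p) : Measurable fun q => tracePoint (D q) (x q) o j := by
  cases o with
  | none => exact (measurable_pi_apply j).comp hx
  | some i => exact measurable_feature hD i j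

theorem measurable_traceStep (hD : Measurable D) (hx : Measurable x) (S : Finset (Fin n)) (T : ℕ)
    (d : Fin mtry ↪ Fin p) (t : TraceState n) :
    Measurable[_, ⊤] fun q => traceStep (D q) (x q) S T d t := by
  unfold traceStep
  split_ifs
  · exact @measurable_const _ _ ⊤ _ _
  obtain ⟨_ | ⟨B, Q⟩, U⟩ := t
  · exact @measurable_const _ _ ⊤ _ _
  refine @measurable_bestCut_comp _ _ _ _ _ _ _ ⊤ hD (tracePoints S B) d
    (fun q c => traceCut (D q) (x q) B Q U c) (@measurable_const _ _ ⊤ _ _) fun j i k => ?_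
  have hm := measurable_midpointCut hD j i k
  have hl : Measurable[_, ⊤] fun q =>
      {o | o ∈ B ∧ tracePoint (D q) (x q) o j < midpointCut (D q) j i k} :=
    measurable_set_of_mem fun o =>
      (MeasurableSet.const _).inter (measurableSet_lt (measurable_tracePoint hD hx o j) hm)
  have hr : Measurable[_, ⊤] fun q =>
      {o | o ∈ B ∧ midpointCut (D q) j i k ≤ tracePoint (D q) (x q) o j} :=
    measurable_set_of_mem fun o =>
      (MeasurableSet.const _).inter (measurableSet_le hm (measurable_tracePoint hD hx o j))
  simp only [traceCut]
  exact @measurable_countable_index _ _ _ _ _ ⊤ _ (fun L q => ((Q ++ [L, _], U) : TraceState n)) hl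
    fun L => @measurable_countable_index _ _ _ _ _ ⊤ _
      (fun R _ => ((Q ++ [L, R], U) : TraceState n)) hr fun R => @measurable_const _ _ ⊤ _ _

theorem measurable_foldl_traceStep (hD : Measurable D) (hx : Measurable x) (S : Finset (Fin n))
    (T : ℕ) (ds : List (Fin mtry ↪ Fin p)) (t : TraceState n) :
    Measurable[_, ⊤] fun q => ds.foldl (fun t d => traceStep (D q) (x q) S T d t) t := by
  induction ds generalizing t with
  | nil => exact @measurable_const _ _ ⊤ _ _
  | cons d ds ih =>
    exact @measurable_countable_index _ _ _ _ _ ⊤ _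
      (fun t q => ds.foldl (fun t d => traceStep (D q) (x q) S T d t) t)
      (measurable_traceStep hD hx S T d t) ih

theorem treePredict_eq_trace (D : Sample n p) (T : ℕ) (θ : TreeParam n p mtry) (x : Fin p → ℝ) :
    ∃ J : Finset (Fin n), treePredict D T θ x = meanResponse D J ∧
      ∀ i, i ∈ J ↔ i ∈ θ.sample ∧
        ∃ B ∈ ((List.ofFn θ.draws).foldl (fun t d => traceStep D x θ.sample T d t)
          (stateTrace D x ⟨[Set.univ], []⟩)).1 ++
          ((List.ofFn θ.draws).foldl (fun t d => traceStep D x θ.sample T d t)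
          (stateTrace D x ⟨[Set.univ], []⟩)).2, none ∈ B ∧ some i ∈ B := by
  classical
  refine ⟨θ.sample.filter fun i => ∃ A ∈ treeLeaves D T θ, x ∈ A ∧ (D i).1 ∈ A,
    by rw [treePredict], fun i => ?_⟩
  rw [← stateTrace_foldl, Finset.mem_filter]
  simp only [treeLeaves, GrowState.leaves, stateTrace, ← List.map_append, List.mem_map]
  refine and_congr_right fun _ => ⟨?_, ?_⟩
  · rintro ⟨A, hA, hx, hi⟩
    exact ⟨_, ⟨A, hA, rfl⟩, hx, hi⟩
  · rintro ⟨_, ⟨A, hA, rfl⟩, hx, hi⟩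
    exact ⟨A, hA, hx, hi⟩

theorem measurable_treePredict (hD : Measurable D) (hx : Measurable x) (T : ℕ)
    (θ : TreeParam n p mtry) : Measurable fun q => treePredict (D q) T θ (x q) := by
  choose J hJ hmem using fun q => treePredict_eq_trace (D q) T θ (x q)
  simp only [hJ]
  have h0 : ∀ q, stateTrace (D q) (x q) ⟨[Set.univ], []⟩ =
      (([Set.univ], []) : TraceState n) := fun q => by
    simp [stateTrace, cellTrace]
  simp only [h0] at hmem
  refine measurable_countable_index (g := fun J q => meanResponse (D q) J) ?_ fun J =>
    measurable_meanResponse hD J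
  refine measurable_finset_of_mem fun i => ?_
  simp only [hmem]
  exact measurable_foldl_traceStep hD hx θ.sample T _ _ (show MeasurableSet[⊤] {t : TraceState n |
    i ∈ θ.sample ∧ ∃ B ∈ t.1 ++ t.2, none ∈ B ∧ some i ∈ B} from trivial)

end Traces

/-! ## Positive correlation of symmetric kernels -/

section Kernels

variable {ι E : Type*} [Fintype ι] [MeasurableSpace E] (ρ : Measure E) [IsProbabilityMeasure ρ]

/-- Distinct coordinates of an iid vector form an iid vector. -/
theorem map_pi_comp_injective {κ : Type*} [Fintype κ] {τ : ι → κ} (hτ : τ.Injective) :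
    (Measure.pi fun _ : κ => ρ).map (fun u i => u (τ i)) = Measure.pi fun _ : ι => ρ := by
  have h := (iIndepFun_pi (μ := fun _ : κ => ρ) (X := fun _ => id)
    fun _ => aemeasurable_id).precomp hτ
  have h' := h.map_fun_eq_pi_map fun i => (measurable_pi_apply (τ i)).aemeasurable
  refine h'.trans ?_
  congr 1
  funext i
  exact (measurePreserving_eval (fun _ : κ => ρ) (τ i)).map_eq

/-- If `F` depends only on the coordinates in `S`, and the permutation `π` maps every element of
`S` to itself or out of `S`, then `F (z)` and `F (z ∘ π)` are conditionally iid given the common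
coordinates, hence nonnegatively correlated. -/
theorem integral_mul_comp_perm_nonneg {F : (ι → E) → ℝ} {S : Set ι} (hF : Measurable F)
    (hS : DependsOn F S) (π : Equiv.Perm ι) (hπ : ∀ i ∈ S, π i ∈ S → π i = i) :
    0 ≤ ∫ z, F z * F (fun i => z (π i)) ∂(Measure.pi fun _ : ι => ρ) := by
  classical
  set ν := Measure.pi fun _ : ι => ρ
  let τ : ι → ι ⊕ (ι ⊕ ι) := fun i =>
    if i ∈ S then (if π i = i then .inl i else .inr (.inl i))
    else (if π.symm i ∈ S then .inr (.inr (π.symm i)) else .inl i)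
  have hτ : τ.Injective := by
    intro i k h
    simp only [τ] at h
    split_ifs at h <;> simp_all
  let G : (ι → E) → (ι → E) → ℝ := fun v w => F fun i => if π i = i then v i else w i
  have h1 (u : ι ⊕ (ι ⊕ ι) → E) : F (fun i => u (τ i)) =
      G (fun i => u (.inl i)) (fun i => u (.inr (.inl i))) := by
    refine hS fun i hi => ?_
    simp only [τ, if_pos hi]
    split_ifs <;> rfl
  have h2 (u : ι ⊕ (ι ⊕ ι) → E) : F (fun i => u (τ (π i))) =
      G (fun i => u (.inl i)) (fun i => u (.inr (.inr i))) := by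
    refine hS fun i hi => ?_
    by_cases hfix : π i = i
    · simp [τ, hi, hfix]
    · have : π i ∉ S := fun h => hfix (hπ i hi h)
      simp [τ, this, hi, hfix]
  have hmeas : Measurable fun z : ι → E => F z * F (fun i => z (π i)) :=
    hF.mul (hF.comp (measurable_pi_lambda _ fun i => measurable_pi_apply _))
  have hτm : Measurable fun (u : ι ⊕ (ι ⊕ ι) → E) (i : ι) => u (τ i) :=
    measurable_pi_lambda _ fun i => measurable_pi_apply _
  have hmp : MeasurePreserving (fun u : ι ⊕ (ι ⊕ ι) → E =>
      ((fun i => u (.inl i), fun i => u (.inr (.inl i)), fun i => u (.inr (.inr i))) :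
        (ι → E) × (ι → E) × (ι → E)))
      (Measure.pi fun _ : ι ⊕ (ι ⊕ ι) => ρ) (ν.prod (ν.prod ν)) :=
    ((MeasurePreserving.id ν).prod (measurePreserving_sumPiEquivProdPi fun _ : ι ⊕ ι => ρ)).comp
      (measurePreserving_sumPiEquivProdPi fun _ : ι ⊕ (ι ⊕ ι) => ρ)
  have hGm : Measurable fun t : (ι → E) × (ι → E) => G t.1 t.2 := by
    refine hF.comp (measurable_pi_lambda _ fun i => ?_)
    by_cases hfix : π i = i
    · simp only [if_pos hfix]; fun_prop
    · simp only [if_neg hfix]; fun_prop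
  have hGG : Measurable fun t : (ι → E) × (ι → E) × (ι → E) => G t.1 t.2.1 * G t.1 t.2.2 :=
    (hGm.comp (measurable_fst.prodMk (measurable_fst.comp measurable_snd))).mul
      (hGm.comp (measurable_fst.prodMk (measurable_snd.comp measurable_snd)))
  have key : ∫ z, F z * F (fun i => z (π i)) ∂ν =
      ∫ t, G t.1 t.2.1 * G t.1 t.2.2 ∂(ν.prod (ν.prod ν)) := by
    rw [← hmp.map_eq, integral_map hmp.measurable.aemeasurable hGG.aestronglyMeasurable,
      show ν = _ from (map_pi_comp_injective ρ hτ).symm,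
      integral_map hτm.aemeasurable hmeas.aestronglyMeasurable]
    simp only [h1, h2]
  rw [key]
  by_cases hint : Integrable (fun t : (ι → E) × (ι → E) × (ι → E) => G t.1 t.2.1 * G t.1 t.2.2)
      (ν.prod (ν.prod ν))
  · rw [integral_prod _ hint]
    refine integral_nonneg fun v => ?_
    dsimp only
    rw [integral_prod_mul (G v) (G v)]
    exact mul_self_nonneg _
  · rw [integral_undef hint]

end Kernels

/-- Dropping some of finitely many nonnegatively correlated summands decreases the second
moment of the sum. -/
theorem integral_sq_sum_le_of_subset {Ω κ : Type*} [MeasurableSpace Ω] {μ : Measure Ω}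
    {h : κ → Ω → ℝ} {V W : Finset κ} (hVW : V ⊆ W) (hL : ∀ s ∈ W, MemLp (h s) 2 μ)
    (hpos : ∀ s ∈ W, ∀ t ∈ W, 0 ≤ ∫ ω, h s ω * h t ω ∂μ) :
    ∫ ω, (∑ s ∈ V, h s ω) ^ 2 ∂μ ≤ ∫ ω, (∑ s ∈ W, h s ω) ^ 2 ∂μ := by
  have hexp (U : Finset κ) (hU : U ⊆ W) :
      ∫ ω, (∑ s ∈ U, h s ω) ^ 2 ∂μ = ∑ c ∈ U ×ˢ U, ∫ ω, h c.1 ω * h c.2 ω ∂μ := by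
    rw [← integral_finsetSum]
    · congr with ω
      rw [sq, Finset.sum_mul_sum, Finset.sum_product]
    · intro c hc
      rw [Finset.mem_product] at hc
      exact (hL _ (hU hc.1)).integrable_mul (hL _ (hU hc.2))
  rw [hexp V hVW, hexp W subset_rfl]
  refine Finset.sum_le_sum_of_subset_of_nonneg (Finset.product_subset_product hVW hVW)
    fun c hc _ => ?_
  rw [Finset.mem_product] at hc
  exact hpos _ hc.1 _ hc.2

/-- Two finite sets of the same size are exchanged by a permutation which fixes their common
elements. -/
theorem exists_perm_map_eq {α : Type*} [DecidableEq α] {S S' : Finset α} (h : S.card = S'.card) :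
    ∃ π : Equiv.Perm α, S.map π.toEmbedding = S' ∧ ∀ i ∈ S, π i ∈ S → π i = i := by
  have hc : (S \ S').card = (S' \ S).card := Finset.card_sdiff_comm h
  let e : {x // x ∈ S \ S'} ≃ {x // x ∈ S' \ S} := Finset.equivOfCardEq hc
  let f : α → α := fun i => if hi : i ∈ S \ S' then e ⟨i, hi⟩
    else if hi : i ∈ S' \ S then e.symm ⟨i, hi⟩ else i
  have f1 (i) (hi : i ∈ S \ S') : f i = e ⟨i, hi⟩ := dif_pos hi
  have f2 (i) (hi : i ∈ S' \ S) : f i = e.symm ⟨i, hi⟩ := by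
    have : i ∉ S \ S' := by simp only [Finset.mem_sdiff] at hi ⊢; tauto
    simp only [f, dif_neg this, dif_pos hi]
  have f3 (i) (hi : i ∉ S \ S') (hi' : i ∉ S' \ S) : f i = i := by
    simp only [f, dif_neg hi, dif_neg hi']
  have hf : Function.Involutive f := by
    intro i
    by_cases hi : i ∈ S \ S'
    · rw [f1 i hi, f2 _ (e ⟨i, hi⟩).2]; simp
    · by_cases hi' : i ∈ S' \ S
      · rw [f2 i hi', f1 _ (e.symm ⟨i, hi'⟩).2]; simp
      · rw [f3 i hi hi', f3 i hi hi']
  have hS (i) (hi : i ∈ S) : f i ∈ S' := by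
    by_cases hi' : i ∈ S'
    · rw [f3 i (by simp [hi']) (by simp [hi])]; exact hi'
    · have hi : i ∈ S \ S' := by simp [hi, hi']
      rw [f1 i hi]; exact (Finset.mem_sdiff.1 (e ⟨i, hi⟩).2).1
  refine ⟨hf.toPerm, ?_, fun i hi hi' => ?_⟩
  · refine Finset.eq_of_subset_of_card_le (fun k hk => ?_) (by rw [Finset.card_map, h])
    obtain ⟨i, hi, rfl⟩ := Finset.mem_map.1 hk
    exact hS i hi
  · change f i ∈ S at hi'
    change f i = i
    by_cases hn : i ∈ S \ S'
    · rw [f1 i hn] at hi'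
      exact absurd hi' (Finset.mem_sdiff.1 (e ⟨i, hn⟩).2).2
    · exact f3 i hn (by simp [hi])

/-! ## Averages over all trees and the limits of infinitely many trees -/

section TreeAverage

variable {n p mtry : ℕ}

/-- A tree parameter is a subsample together with the draws of directions. -/
def treeParamEquiv (n p mtry : ℕ) :
    TreeParam n p mtry ≃ Finset (Fin n) × (Fin (2 * n) → (Fin mtry ↪ Fin p)) where
  toFun θ := (θ.sample, θ.draws)
  invFun c := ⟨c.1, c.2⟩
  left_inv _ := rfl
  right_inv _ := rfl

instance (n p mtry : ℕ) : Fintype (TreeParam n p mtry) :=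
  Fintype.ofEquiv _ (treeParamEquiv n p mtry).symm

open Classical in
/-- The trees whose subsample belongs to `Q`. -/
def treesOn (p mtry : ℕ) (Q : Finset (Finset (Fin n))) : Finset (TreeParam n p mtry) :=
  Finset.univ.filter fun θ => θ.sample ∈ Q

theorem mem_treesOn {Q : Finset (Finset (Fin n))} {θ : TreeParam n p mtry} :
    θ ∈ treesOn p mtry Q ↔ θ.sample ∈ Q := by
  simp [treesOn]

theorem sum_treesOn (Q : Finset (Finset (Fin n))) (f : TreeParam n p mtry → ℝ) :
    ∑ θ ∈ treesOn p mtry Q, f θ = ∑ S ∈ Q, ∑ e, f ⟨S, e⟩ := by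
  classical
  rw [← Finset.sum_product']
  refine Finset.sum_bij' (fun θ _ => (θ.sample, θ.draws)) (fun c _ => ⟨c.1, c.2⟩) ?_ ?_ ?_ ?_ ?_
  · intro θ hθ; simpa [mem_treesOn] using hθ
  · intro c hc; simpa [mem_treesOn] using hc
  all_goals intros; rfl

theorem card_treesOn (Q : Finset (Finset (Fin n))) :
    ((treesOn p mtry Q).card : ℝ) =
      Q.card * (Fintype.card (Fin (2 * n) → (Fin mtry ↪ Fin p)) : ℝ) := by
  have h := sum_treesOn (p := p) (mtry := mtry) Q fun _ => 1
  simpa only [Finset.sum_const, nsmul_eq_mul, mul_one, Finset.card_univ] using h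

theorem card_draws_pos (n : ℕ) (h : mtry ≤ p) :
    (0 : ℝ) < (Fintype.card (Fin (2 * n) → (Fin mtry ↪ Fin p)) : ℝ) := by
  have : Nonempty (Fin mtry ↪ Fin p) := ⟨Fin.castLEEmb h⟩
  exact_mod_cast Fintype.card_pos

/-- The average prediction of the trees whose subsample belongs to `Q`. -/
def treeAverage (mtry : ℕ) (D : Sample n p) (T : ℕ) (Q : Finset (Finset (Fin n)))
    (x : Fin p → ℝ) : ℝ :=
  (∑ θ ∈ treesOn p mtry Q, treePredict D T θ x) / ((treesOn p mtry Q).card : ℝ)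

theorem abs_treeAverage_le (D : Sample n p) (T : ℕ) (Q : Finset (Finset (Fin n)))
    (x : Fin p → ℝ) : |treeAverage mtry D T Q x| ≤ absResponseSum D :=
  abs_sum_div_card_le _ _ (absResponseSum_nonneg D) fun _ _ => abs_treePredict_le D T _ _

theorem measurable_treeAverage {α : Type*} [MeasurableSpace α] {D : α → Sample n p}
    {x : α → Fin p → ℝ} (hD : Measurable D) (hx : Measurable x) (T : ℕ)
    (Q : Finset (Finset (Fin n))) : Measurable fun q => treeAverage mtry (D q) T Q (x q) := by
  simp only [treeAverage]
  exact (Finset.measurable_sum _ fun θ _ => measurable_treePredict hD hx T θ).div_const _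

theorem treeAverage_congr {D D' : Sample n p} {Q : Finset (Finset (Fin n))}
    (hD : ∀ S ∈ Q, ∀ i ∈ S, D' i = D i) (T : ℕ) (x : Fin p → ℝ) :
    treeAverage mtry D' T Q x = treeAverage mtry D T Q x := by
  have h : ∀ θ ∈ treesOn p mtry Q, treePredict D' T θ x = treePredict D T θ x := fun θ hθ =>
    treePredict_congr (hD θ.sample (mem_treesOn.1 hθ)) T θ.draws x
  rw [treeAverage, treeAverage, Finset.sum_congr rfl h]

/-- The subsamples of size `a`. -/
def subsamples (n a : ℕ) : Finset (Finset (Fin n)) := Finset.powersetCard a Finset.univ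

/-- The subsamples of size `a` which do not contain observation `i`. -/
def oobSubsamples (n a : ℕ) (i : Fin n) : Finset (Finset (Fin n)) :=
  Finset.powersetCard a (Finset.univ.erase i)

theorem mem_subsamples {a : ℕ} {S : Finset (Fin n)} : S ∈ subsamples n a ↔ S.card = a := by
  simp [subsamples]

theorem mem_oobSubsamples {a : ℕ} {i : Fin n} {S : Finset (Fin n)} :
    S ∈ oobSubsamples n a i ↔ i ∉ S ∧ S.card = a := by
  simp [oobSubsamples, Finset.mem_powersetCard, Finset.subset_erase]

theorem oobSubsamples_subset (a : ℕ) (i : Fin n) : oobSubsamples n a i ⊆ subsamples n a :=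
  fun _ hS => mem_subsamples.2 (mem_oobSubsamples.1 hS).2

theorem card_oobSubsamples_mul (a : ℕ) (ha : a ≤ n) (i : Fin n) :
    ((oobSubsamples n a i).card : ℝ) * n = (subsamples n a).card * (n - a : ℝ) := by
  rw [oobSubsamples, subsamples, Finset.card_powersetCard, Finset.card_powersetCard,
    Finset.card_erase_of_mem (Finset.mem_univ i), Finset.card_univ, Fintype.card_fin]
  obtain ⟨k, rfl⟩ : ∃ k, n = k + 1 := ⟨n - 1, by have := i.2; omega⟩
  have h := Nat.choose_mul_succ_eq k a
  rw [← Nat.cast_sub ha]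
  exact_mod_cast h

end TreeAverage

section Limits

variable {n p mtry a : ℕ} {Ω : Type*} [MeasurableSpace Ω] {P : Measure Ω}
  {θ : ℕ → Ω → TreeParam n p mtry}

theorem ae_card_sample_eq
    (hlaw : ∀ k, HasLaw (θ k) (uniformOn {t : TreeParam n p mtry | t.sample.card = a}) P) :
    ∀ᵐ ω ∂P, ∀ k, (θ k ω).sample.card = a := by
  rw [ae_all_iff]
  intro k
  have h : ∀ᵐ t ∂(uniformOn {t : TreeParam n p mtry | t.sample.card = a}), t.sample.card = a := by
    rw [uniformOn]
    exact ae_cond_mem (DiscreteMeasurableSpace.forall_measurableSet _)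
  rw [← (hlaw k).map_eq] at h
  exact ae_of_ae_map (hlaw k).aemeasurable h

theorem ae_tendsto_average [IsProbabilityMeasure P]
    (hlaw : ∀ k, HasLaw (θ k) (uniformOn {t : TreeParam n p mtry | t.sample.card = a}) P)
    (hind : iIndepFun θ P) :
    ∀ᵐ ω ∂P, ∀ g : TreeParam n p mtry → ℝ,
      Tendsto (fun M : ℕ => (∑ k ∈ Finset.range M, g (θ k ω)) / (M : ℝ)) atTop
        (𝓝 ((∑ t ∈ treesOn p mtry (subsamples n a), g t) /
          ((treesOn p mtry (subsamples n a)).card : ℝ))) := by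
  classical
  have hset : {t : TreeParam n p mtry | t.sample.card = a} =
      (treesOn p mtry (subsamples n a) : Set (TreeParam n p mtry)) := by
    ext t; simp [mem_treesOn, mem_subsamples]
  have hX : ∀ t : TreeParam n p mtry, ∀ᵐ ω ∂P, Tendsto
      (fun M : ℕ => (∑ k ∈ Finset.range M, if θ k ω = t then (1 : ℝ) else 0) / (M : ℝ)) atTop
      (𝓝 (if t ∈ treesOn p mtry (subsamples n a) then
        1 / ((treesOn p mtry (subsamples n a)).card : ℝ) else 0)) := by
    intro t
    let f : TreeParam n p mtry → ℝ := fun s => if s = t then 1 else 0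
    have hf : Measurable f := measurable_of_countable f
    have hid (k) : IdentDistrib (fun ω => f (θ k ω)) (fun ω => f (θ 0 ω)) P P :=
      (IdentDistrib.mk (hlaw k).aemeasurable (hlaw 0).aemeasurable
        ((hlaw k).map_eq.trans (hlaw 0).map_eq.symm)).comp hf
    have hint : Integrable (fun ω => f (θ 0 ω)) P := by
      refine Integrable.of_bound (hf.comp_aemeasurable (hlaw 0).aemeasurable).aestronglyMeasurable 1
        (ae_of_all _ fun ω => ?_)
      simp only [f]
      split_ifs <;> simp
    have h := strong_law_ae_real (fun k ω => f (θ k ω)) hint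
      (fun i j hij => (hind.indepFun hij).comp hf hf) hid
    have hmean : ∫ ω, f (θ 0 ω) ∂P = if t ∈ treesOn p mtry (subsamples n a) then
        1 / ((treesOn p mtry (subsamples n a)).card : ℝ) else 0 := by
      have hcomp := (hlaw 0).integral_comp (f := f) hf.aestronglyMeasurable
      rw [Function.comp_def] at hcomp
      rw [hcomp, hset]
      have hfi : f = ({t} : Set (TreeParam n p mtry)).indicator 1 := by
        funext s
        simp [f, Set.indicator_apply]
      rw [hfi, integral_indicator_one (MeasurableSet.singleton t), Measure.real,
        ← Finset.coe_singleton, uniformOn_apply_finset]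
      split_ifs with ht
      · rw [Finset.inter_singleton_of_mem ht]
        simp
      · rw [Finset.inter_singleton_of_notMem ht]
        simp
    rw [hmean] at h
    exact h
  filter_upwards [ae_all_iff.2 hX] with ω hω g
  have hsum : ∀ M : ℕ, (∑ k ∈ Finset.range M, g (θ k ω)) / (M : ℝ) =
      ∑ t, g t * ((∑ k ∈ Finset.range M, if θ k ω = t then (1 : ℝ) else 0) / (M : ℝ)) := by
    intro M
    simp only [← mul_div_assoc, ← Finset.sum_div, Finset.mul_sum]
    rw [Finset.sum_comm]
    simp
  simp only [hsum]
  have hlim := tendsto_finsetSum (Finset.univ : Finset (TreeParam n p mtry))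
    fun t _ => (hω t).const_mul (g t)
  convert hlim using 2
  simp only [mul_ite, mul_zero, Finset.sum_div]
  rw [← Finset.sum_filter]
  simp [div_eq_mul_inv]

variable {D : Sample n p} {T : ℕ} {ϑ : ℕ → TreeParam n p mtry}

theorem infForestPredict_eq
    (h : ∀ g : TreeParam n p mtry → ℝ,
      Tendsto (fun M : ℕ => (∑ k ∈ Finset.range M, g (ϑ k)) / (M : ℝ)) atTop
        (𝓝 ((∑ t ∈ treesOn p mtry (subsamples n a), g t) /
          ((treesOn p mtry (subsamples n a)).card : ℝ)))) (x : Fin p → ℝ) :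
    infForestPredict D T ϑ x = treeAverage mtry D T (subsamples n a) x :=
  (h fun t => treePredict D T t x).limUnder_eq

theorem tendsto_oobPredict
    (h : ∀ g : TreeParam n p mtry → ℝ,
      Tendsto (fun M : ℕ => (∑ k ∈ Finset.range M, g (ϑ k)) / (M : ℝ)) atTop
        (𝓝 ((∑ t ∈ treesOn p mtry (subsamples n a), g t) /
          ((treesOn p mtry (subsamples n a)).card : ℝ))))
    (hcard : ∀ k, (ϑ k).sample.card = a) (i : Fin n) :
    Tendsto (fun M => oobPredict D T ϑ M i) atTop
      (𝓝 (treeAverage mtry D T (oobSubsamples n a i) (D i).1)) := by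
  classical
  have hfil : treesOn p mtry (oobSubsamples n a i) =
      (treesOn p mtry (subsamples n a)).filter fun t => i ∉ t.sample := by
    ext t
    rw [Finset.mem_filter, mem_treesOn, mem_treesOn, mem_oobSubsamples, mem_subsamples, and_comm]
  rcases (treesOn p mtry (oobSubsamples n a i)).eq_empty_or_nonempty with hempty | hne
  · have hoob (M : ℕ) : oobTrees ϑ M i = ∅ := by
      rw [oobTrees, Finset.filter_eq_empty_iff]
      intro k _ hk
      have : ϑ k ∈ treesOn p mtry (oobSubsamples n a i) :=
        mem_treesOn.2 (mem_oobSubsamples.2 ⟨hk, hcard k⟩)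
      rw [hempty] at this
      exact absurd this (Finset.notMem_empty _)
    simp [oobPredict, hoob, treeAverage, hempty]
  · have hc : ((treesOn p mtry (oobSubsamples n a i)).card : ℝ) ≠ 0 := by
      exact_mod_cast hne.card_pos.ne'
    have hc' : ((treesOn p mtry (subsamples n a)).card : ℝ) ≠ 0 := by
      have : (treesOn p mtry (subsamples n a)).Nonempty := by
        rw [hfil] at hne
        exact hne.mono (Finset.filter_subset _ _)
      exact_mod_cast this.card_pos.ne'
    have hnum := h fun t => if i ∉ t.sample then treePredict D T t (D i).1 else 0
    have hden := h fun t => if i ∉ t.sample then 1 else 0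
    rw [← Finset.sum_filter, ← hfil] at hnum hden
    rw [Finset.sum_const, nsmul_eq_mul, mul_one] at hden
    have hlim := hnum.div hden (div_ne_zero hc hc')
    rw [div_div_div_cancel_right₀ hc'] at hlim
    refine hlim.congr' ?_
    filter_upwards [eventually_ne_atTop 0] with M hM
    have hM' : (M : ℝ) ≠ 0 := by exact_mod_cast hM
    dsimp only [Pi.div_apply]
    rw [div_div_div_cancel_right₀ hM', ← Finset.sum_filter, ← Finset.sum_filter, oobPredict,
      oobTrees, Finset.sum_const, nsmul_eq_mul, mul_one]

/-- The residual variance estimator of the infinite forest. -/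
def limitSigmaSq (mtry : ℕ) (D : Sample n p) (T a : ℕ) : ℝ :=
  (∑ i : Fin n, ((D i).2 - treeAverage mtry D T (oobSubsamples n a i) (D i).1) ^ 2) / (n : ℝ)

theorem limitSigmaSq_nonneg (D : Sample n p) (T a : ℕ) : 0 ≤ limitSigmaSq mtry D T a :=
  div_nonneg (Finset.sum_nonneg fun _ _ => sq_nonneg _) (Nat.cast_nonneg _)

theorem tendsto_sigmaSqOOB
    (h : ∀ i, Tendsto (fun M => oobPredict D T ϑ M i) atTop
      (𝓝 (treeAverage mtry D T (oobSubsamples n a i) (D i).1))) :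
    Tendsto (fun M => sigmaSqOOB D T ϑ M) atTop (𝓝 (limitSigmaSq mtry D T a)) :=
  (tendsto_finsetSum _ fun i _ => ((h i).const_sub _).pow 2).div_const _

theorem tendsto_sigmaSqWeighted
    (h : Tendsto (fun M => sigmaSqOOB D T ϑ M) atTop (𝓝 (limitSigmaSq mtry D T a))) (l : ℝ) :
    Tendsto (fun M => sigmaSqWeighted D T ϑ l M) atTop (𝓝 (limitSigmaSq mtry D T a)) := by
  have h8 : Tendsto (fun M : ℕ => 8 / (M : ℝ)) atTop (𝓝 0) := tendsto_const_div_atTop_nhds_zero_nat 8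
  have hcor : Tendsto (fun M : ℕ => 8 / (M : ℝ) *
      ((⨆ i : Fin n, |oobPredict D T ϑ M i|) ^ 2
        + sigmaSqOOB D T ϑ M * (1 + 4 * Real.log (n : ℝ)))) atTop (𝓝 0) := by
    refine squeeze_zero_norm (a := fun M : ℕ => 8 / (M : ℝ) *
      ((5 + 16 * Real.log n) * absResponseSum D ^ 2)) (fun M => ?_) ?_
    · rw [Real.norm_eq_abs, abs_mul, abs_of_nonneg (by positivity : 0 ≤ 8 / (M : ℝ))]
      exact mul_le_mul_of_nonneg_left (abs_correction_le D T ϑ M) (by positivity)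
    · simpa using h8.mul_const ((5 + 16 * Real.log n) * absResponseSum D ^ 2)
  have hc := ((h.sub hcor).abs.const_mul l).add (h.const_mul (1 - l))
  rw [sub_zero, abs_of_nonneg (limitSigmaSq_nonneg D T a), ← add_mul, add_sub_cancel, one_mul] at hc
  exact hc

end Limits

/-! ## Out-of-bag error and generalization error -/

section SecondMoments

variable {n p : ℕ}

/-- The training sample in a vector of observations; the entry at `none` is the unseen one. -/
def sampleOf (z : Option (Fin n) → (Fin p → ℝ) × ℝ) : Sample n p := fun i => z (some i)

theorem measurable_sampleOf : Measurable (sampleOf (n := n) (p := p)) :=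
  measurable_pi_lambda _ fun i => measurable_pi_apply (some i)

/-- The summed errors at the unseen observation of the trees with subsample `S`. -/
def subsampleError (mtry T : ℕ) (m : (Fin p → ℝ) → ℝ) (S : Finset (Fin n))
    (z : Option (Fin n) → (Fin p → ℝ) × ℝ) : ℝ :=
  ∑ e : Fin (2 * n) → (Fin mtry ↪ Fin p),
    (treePredict (sampleOf z) T ⟨S, e⟩ (z none).1 - m (z none).1)

variable {mtry T : ℕ} {m : (Fin p → ℝ) → ℝ}

theorem measurable_subsampleError (hm : Measurable m) (S : Finset (Fin n)) :
    Measurable (subsampleError mtry T m S) :=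
  Finset.measurable_sum _ fun e _ =>
    (measurable_treePredict measurable_sampleOf (by fun_prop) T ⟨S, e⟩).sub
      (hm.comp (by fun_prop))

theorem dependsOn_subsampleError (S : Finset (Fin n)) :
    DependsOn (subsampleError mtry T m S) (insert none (some '' (S : Set (Fin n)))) := by
  intro z z' h
  have h0 : z none = z' none := h none (Set.mem_insert _ _)
  refine Finset.sum_congr rfl fun e _ => ?_
  rw [h0, treePredict_congr (D := sampleOf z') (D' := sampleOf z)]
  exact fun i hi => h (some i) (Set.mem_insert_of_mem _ ⟨i, hi, rfl⟩)

theorem subsampleError_map (π : Equiv.Perm (Fin n)) (S : Finset (Fin n))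
    (z : Option (Fin n) → (Fin p → ℝ) × ℝ) :
    subsampleError mtry T m (S.map π.toEmbedding) z =
      subsampleError mtry T m S (fun o => z (Equiv.optionCongr π o)) := by
  refine Finset.sum_congr rfl fun e _ => ?_
  rw [treePredict_map (φ := π.toEmbedding) (D := sampleOf fun o => z (Equiv.optionCongr π o))
    (D' := sampleOf z) fun i _ => rfl]
  rfl

theorem treeAverage_sub_eq {D : Sample n p} {Q : Finset (Finset (Fin n))} {x : Fin p → ℝ}
    (hc : ((treesOn p mtry Q).card : ℝ) ≠ 0) (y : ℝ) :
    treeAverage mtry D T Q x - y =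
      (∑ S ∈ Q, ∑ e : Fin (2 * n) → (Fin mtry ↪ Fin p), (treePredict D T ⟨S, e⟩ x - y)) /
        ((treesOn p mtry Q).card : ℝ) := by
  rw [← sum_treesOn Q fun θ => treePredict D T θ x - y, Finset.sum_sub_distrib, Finset.sum_const,
    nsmul_eq_mul, sub_div, mul_div_cancel_left₀ _ hc, treeAverage]

variable {ρ : Measure ((Fin p → ℝ) × ℝ)} [IsProbabilityMeasure ρ]

theorem memLp_subsampleError (hY : MemLp Prod.snd 2 ρ)
    (hmL : MemLp (fun e => m e.1) 2 ρ) (S : Finset (Fin n)) :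
    MemLp (subsampleError mtry T m S) 2 (Measure.pi fun _ : Option (Fin n) => ρ) := by
  have hev (o : Option (Fin n)) := measurePreserving_eval (fun _ : Option (Fin n) => ρ) o
  have hsum : MemLp (fun z : Option (Fin n) → (Fin p → ℝ) × ℝ => absResponseSum (sampleOf z)) 2
      (Measure.pi fun _ => ρ) :=
    memLp_finsetSum _ fun i _ => (hY.comp_measurePreserving (hev (some i))).abs
  refine memLp_finsetSum _ fun e _ => MemLp.sub ?_ (hmL.comp_measurePreserving (hev none))
  refine hsum.mono' (measurable_treePredict measurable_sampleOf (by fun_prop) T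
    ⟨S, e⟩).aestronglyMeasurable (ae_of_all _ fun z => ?_)
  exact abs_treePredict_le _ T _ _

theorem integral_subsampleError_mul_nonneg (hm : Measurable m) {S S' : Finset (Fin n)}
    (hc : S.card = S'.card) :
    0 ≤ ∫ z, subsampleError mtry T m S z * subsampleError mtry T m S' z
      ∂(Measure.pi fun _ : Option (Fin n) => ρ) := by
  obtain ⟨π, rfl, hπ⟩ := exists_perm_map_eq hc
  simp only [subsampleError_map π S]
  refine integral_mul_comp_perm_nonneg ρ (measurable_subsampleError hm S)
    (dependsOn_subsampleError S) (Equiv.optionCongr π) ?_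
  rintro (_ | i) hi hi'
  · rfl
  · have h1 : i ∈ S := by simpa using hi
    have h2 : π i ∈ S := by simpa using hi'
    simp [hπ i h1 h2]

/-- Leaving out the trees grown on observation `i` costs at most the factor `(n / (n - a))²` in
mean squared error. -/
theorem integral_sq_oob_le (hmp : mtry ≤ p) (hm : Measurable m) (hY : MemLp Prod.snd 2 ρ)
    (hmL : MemLp (fun e => m e.1) 2 ρ) {a : ℕ} (ha : a < n) (i : Fin n) :
    ∫ z, (treeAverage mtry (sampleOf z) T (oobSubsamples n a i) (z none).1 - m (z none).1) ^ 2
        ∂(Measure.pi fun _ : Option (Fin n) => ρ) ≤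
      ((n : ℝ) / (n - a)) ^ 2 *
        ∫ z, (treeAverage mtry (sampleOf z) T (subsamples n a) (z none).1 - m (z none).1) ^ 2
          ∂(Measure.pi fun _ : Option (Fin n) => ρ) := by
  set K : ℝ := (Fintype.card (Fin (2 * n) → (Fin mtry ↪ Fin p)) : ℝ)
  have hK : 0 < K := card_draws_pos n hmp
  have hn : (0 : ℝ) < n := by exact_mod_cast (Nat.zero_le a).trans_lt ha
  have hna : (0 : ℝ) < n - a := sub_pos.2 (by exact_mod_cast ha)
  have hQ : (0 : ℝ) < (subsamples n a).card := by
    rw [subsamples, Finset.card_powersetCard, Finset.card_univ, Fintype.card_fin]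
    exact_mod_cast Nat.choose_pos ha.le
  have hQi := card_oobSubsamples_mul a ha.le i
  have hQi0 : (0 : ℝ) < (oobSubsamples n a i).card := by
    have : 0 < ((oobSubsamples n a i).card : ℝ) * n := by rw [hQi]; positivity
    exact pos_of_mul_pos_left this hn.le
  have hc : (0 : ℝ) < (treesOn p mtry (subsamples n a)).card := by
    rw [card_treesOn]; exact mul_pos hQ hK
  have hci : (0 : ℝ) < (treesOn p mtry (oobSubsamples n a i)).card := by
    rw [card_treesOn]; exact mul_pos hQi0 hK
  have hratio : ((n : ℝ) / (n - a)) = (treesOn p mtry (subsamples n a)).card /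
      (treesOn p mtry (oobSubsamples n a i)).card := by
    rw [card_treesOn, card_treesOn, mul_div_mul_right _ _ hK.ne', div_eq_div_iff hna.ne' hQi0.ne',
      ← hQi, mul_comm]
  have hmain := integral_sq_sum_le_of_subset
    (μ := Measure.pi fun _ : Option (Fin n) => ρ) (h := subsampleError mtry T m)
    (oobSubsamples_subset a i) (fun S _ => memLp_subsampleError hY hmL S)
    fun S hS S' hS' => integral_subsampleError_mul_nonneg hm
      ((mem_subsamples.1 hS).trans (mem_subsamples.1 hS').symm)
  have hU (Q : Finset (Finset (Fin n))) (hcQ : (0 : ℝ) < (treesOn p mtry Q).card) :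
      ∫ z, (treeAverage mtry (sampleOf z) T Q (z none).1 - m (z none).1) ^ 2
        ∂(Measure.pi fun _ : Option (Fin n) => ρ) =
      (∫ z, (∑ S ∈ Q, subsampleError mtry T m S z) ^ 2
        ∂(Measure.pi fun _ : Option (Fin n) => ρ)) / ((treesOn p mtry Q).card : ℝ) ^ 2 := by
    rw [← integral_div]
    refine integral_congr_ae (ae_of_all _ fun z => ?_)
    dsimp only
    rw [treeAverage_sub_eq hcQ.ne', div_pow]
    rfl
  rw [hU _ hc, hU _ hci, hratio, div_pow, div_mul_div_comm, mul_comm, mul_div_mul_right _ _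
    (by positivity)]
  gcongr

theorem integral_sq_oob_eq (hm : Measurable m) (a : ℕ) (i : Fin n) :
    ∫ z, (treeAverage mtry (sampleOf z) T (oobSubsamples n a i) (z (some i)).1
        - m (z (some i)).1) ^ 2 ∂(Measure.pi fun _ : Option (Fin n) => ρ) =
      ∫ z, (treeAverage mtry (sampleOf z) T (oobSubsamples n a i) (z none).1 - m (z none).1) ^ 2
        ∂(Measure.pi fun _ : Option (Fin n) => ρ) := by
  classical
  have hmeas : Measurable fun z : Option (Fin n) → (Fin p → ℝ) × ℝ =>
      (treeAverage mtry (sampleOf z) T (oobSubsamples n a i) (z (some i)).1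
        - m (z (some i)).1) ^ 2 :=
    ((measurable_treeAverage measurable_sampleOf (by fun_prop) T _).sub
      (hm.comp (by fun_prop))).pow_const 2
  have hinj := (Equiv.swap none (some i)).injective
  have hτ : Measurable fun (z : Option (Fin n) → (Fin p → ℝ) × ℝ) o =>
      z (Equiv.swap none (some i) o) :=
    measurable_pi_lambda _ fun o => measurable_pi_apply _
  have h := integral_map (μ := Measure.pi fun _ : Option (Fin n) => ρ) hτ.aemeasurable
    hmeas.aestronglyMeasurable
  rw [map_pi_comp_injective ρ hinj] at h
  rw [h]
  refine integral_congr_ae (ae_of_all _ fun z => ?_)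
  dsimp only
  rw [Equiv.swap_apply_right]
  have hA : treeAverage mtry (sampleOf fun o => z (Equiv.swap none (some i) o)) T
      (oobSubsamples n a i) (z none).1 =
      treeAverage mtry (sampleOf z) T (oobSubsamples n a i) (z none).1 := by
    refine treeAverage_congr (fun S hS k hk => ?_) T _
    have hki : some k ≠ some i := fun h =>
      (mem_oobSubsamples.1 hS).1 (by rwa [← Option.some_injective _ h])
    simp only [sampleOf]
    rw [Equiv.swap_apply_of_ne_of_ne (by simp) hki]
  rw [hA]

end SecondMoments

/-- If two families of independent variables are independent of each other, the pairs are
independent. -/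
theorem iIndepFun_prodMk_of_indepFun {Ω ι α β : Type*} [MeasurableSpace Ω] {P : Measure Ω}
    [IsProbabilityMeasure P] [MeasurableSpace α] [MeasurableSpace β] {X : ι → Ω → α}
    {Y : ι → Ω → β} (hXm : ∀ i, Measurable (X i)) (hYm : ∀ i, Measurable (Y i))
    (hX : iIndepFun X P) (hY : iIndepFun Y P)
    (hXY : IndepFun (fun ω i => X i ω) (fun ω i => Y i ω) P) :
    iIndepFun (fun i ω => (X i ω, Y i ω)) P := by
  rw [iIndepFun_iff_finset]
  intro s
  have hpair (i : ι) : P.map (fun ω => (X i ω, Y i ω)) = (P.map (X i)).prod (P.map (Y i)) :=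
    (indepFun_iff_map_prod_eq_prod_map_map (hXm i).aemeasurable (hYm i).aemeasurable).1
      (hXY.comp (measurable_pi_apply i) (measurable_pi_apply i))
  have hXs := iIndepFun.map_fun_eq_pi_map (f := s.restrict X) (fun i => (hXm i).aemeasurable)
    (iIndepFun_iff_finset.1 hX s)
  have hYs := iIndepFun.map_fun_eq_pi_map (f := s.restrict Y) (fun i => (hYm i).aemeasurable)
    (iIndepFun_iff_finset.1 hY s)
  have hXYs : IndepFun (fun ω (i : s) => X i ω) (fun ω (i : s) => Y i ω) P :=
    hXY.comp (φ := fun u (i : s) => u i) (ψ := fun u (i : s) => u i)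
      (measurable_pi_lambda _ fun i => measurable_pi_apply _)
      (measurable_pi_lambda _ fun i => measurable_pi_apply _)
  have hXsm : Measurable fun ω (i : s) => X i ω := measurable_pi_lambda _ fun i => hXm i
  have hYsm : Measurable fun ω (i : s) => Y i ω := measurable_pi_lambda _ fun i => hYm i
  have hjoint := (indepFun_iff_map_prod_eq_prod_map_map hXsm.aemeasurable hYsm.aemeasurable).1 hXYs
  have hprob1 (i : ι) : IsProbabilityMeasure (P.map (X i)) :=
    Measure.isProbabilityMeasure_map (hXm i).aemeasurable
  have hprob2 (i : ι) : IsProbabilityMeasure (P.map (Y i)) :=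
    Measure.isProbabilityMeasure_map (hYm i).aemeasurable
  rw [iIndepFun_iff_map_fun_eq_pi_map (f := s.restrict fun i ω => (X i ω, Y i ω))
    fun i => ((hXm i).prodMk (hYm i)).aemeasurable]
  have hmp := (measurePreserving_arrowProdEquivProdArrow α β s (fun i => P.map (X i))
    fun i => P.map (Y i)).symm
  have h1 : (fun ω (i : s) => s.restrict (fun i ω => (X i ω, Y i ω)) i ω) =
      (MeasurableEquiv.arrowProdEquivProdArrow α β s).symm ∘
        fun ω => (fun (i : s) => X i ω, fun (i : s) => Y i ω) := rfl
  have h2 : (fun i : s => P.map (s.restrict (fun i ω => (X i ω, Y i ω)) i)) =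
      fun i : s => (P.map (X i)).prod (P.map (Y i)) := funext fun i => hpair i
  rw [h1, h2, ← Measure.map_map (MeasurableEquiv.measurable _) (hXsm.prodMk hYsm), hjoint,
    ← hmp.map_eq]
  congr 1
  exact congrArg₂ _ hXs hYs

/-! ## The regression model -/

section Model

variable {Ω : Type*} [MeasurableSpace Ω] {P : Measure Ω} {p : ℕ}
  {m : (Fin p → ℝ) → ℝ} {X : ℕ → Ω → Fin p → ℝ} {ε : ℕ → Ω → ℝ} {σ : ℝ}

/-- The `i`-th observation. -/
def observation (m : (Fin p → ℝ) → ℝ) (X : ℕ → Ω → Fin p → ℝ) (ε : ℕ → Ω → ℝ) (i : ℕ) (ω : Ω) :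
    (Fin p → ℝ) × ℝ :=
  (X i ω, m (X i ω) + ε i ω)

/-- The observations `1, …, n`, together with observation `0` at `none`. -/
def observationVector (m : (Fin p → ℝ) → ℝ) (X : ℕ → Ω → Fin p → ℝ) (ε : ℕ → Ω → ℝ) (n : ℕ)
    (ω : Ω) (o : Option (Fin n)) : (Fin p → ℝ) × ℝ :=
  observation m X ε (o.elim 0 fun i => i + 1) ω

namespace RegressionModel

theorem measurable_observation (h : RegressionModel P m X ε σ) (i : ℕ) :
    Measurable (observation m X ε i) :=
  (h.measurable_X i).prodMk ((h.measurable_m.comp (h.measurable_X i)).add (h.measurable_ε i))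

theorem measurable_trainingData (h : RegressionModel P m X ε σ) (n : ℕ) :
    Measurable (trainingData m X ε n) :=
  measurable_pi_lambda _ fun i => h.measurable_observation (i + 1)

theorem measurable_pair (h : RegressionModel P m X ε σ) :
    Measurable fun e : (Fin p → ℝ) × ℝ => (e.1, m e.1 + e.2) :=
  measurable_fst.prodMk ((h.measurable_m.comp measurable_fst).add measurable_snd)

theorem memLp_error (h : RegressionModel P m X ε σ) (i : ℕ) : MemLp (ε i) 2 P :=
  (h.ident_ε i).symm.memLp_snd h.memLp_ε

theorem integral_error_sq (h : RegressionModel P m X ε σ) (i : ℕ) :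
    ∫ ω, ε i ω ^ 2 ∂P = σ ^ 2 := by
  have h0 := h.variance_ε
  rw [variance_of_integral_eq_zero (h.measurable_ε 0).aemeasurable h.mean_ε] at h0
  rw [← h0]
  exact ((h.ident_ε i).comp (measurable_id.pow_const 2)).integral_eq

theorem measurable_observationVector (h : RegressionModel P m X ε σ) (n : ℕ) :
    Measurable (observationVector m X ε n) :=
  measurable_pi_lambda _ fun _ => h.measurable_observation _

theorem memLp_absResponseSum (h : RegressionModel P m X ε σ)
    (hmX : ∀ i, MemLp (fun ω => m (X i ω)) 2 P) (n : ℕ) :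
    MemLp (fun ω => absResponseSum (trainingData m X ε n ω)) 2 P :=
  memLp_finsetSum _ fun i _ => ((hmX (i + 1)).add (h.memLp_error (i + 1))).abs

theorem tendsto_integral_mean_sq_error (h : RegressionModel P m X ε σ) :
    Tendsto (fun n : ℕ => ∫ ω, |(∑ i : Fin n, ε (i + 1) ω ^ 2) / (n : ℝ) - σ ^ 2| ∂P) atTop
      (𝓝 0) := by
  have hid (i : ℕ) : IdentDistrib (fun ω => ε (i + 1) ω ^ 2) (fun ω => ε (0 + 1) ω ^ 2) P P :=
    ((h.ident_ε (i + 1)).trans (h.ident_ε (0 + 1)).symm).comp (measurable_id.pow_const 2)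
  have hind : Pairwise (Function.onFun (fun f g : Ω → ℝ => IndepFun f g P)
      fun (i : ℕ) ω => ε (i + 1) ω ^ 2) := fun i j hij =>
    (h.iIndep_ε.indepFun (by simpa using hij)).comp (measurable_id.pow_const 2)
      (measurable_id.pow_const 2)
  have hL : MemLp (fun ω => ε (0 + 1) ω ^ 2) 1 P :=
    memLp_one_iff_integrable.2 (h.memLp_error 1).integrable_sq
  have hlaw := strong_law_Lp le_rfl ENNReal.one_ne_top (fun i ω => ε (i + 1) ω ^ 2) hL hind hid
  have hlim := (ENNReal.tendsto_toReal ENNReal.zero_ne_top).comp hlaw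
  refine hlim.congr fun n => ?_
  rw [Function.comp_apply, eLpNorm_one_eq_lintegral_enorm, ← integral_norm_eq_lintegral_enorm]
  · refine integral_congr_ae (ae_of_all _ fun ω => ?_)
    dsimp only
    rw [h.integral_error_sq, smul_eq_mul, Real.norm_eq_abs, inv_mul_eq_div,
      Fin.sum_univ_eq_sum_range fun i => ε (i + 1) ω ^ 2]
  · simp only [smul_eq_mul]
    exact (((Finset.measurable_sum _ fun i _ =>
      (h.measurable_ε (i + 1)).pow_const 2).const_mul _).sub_const _).aestronglyMeasurable

variable [IsProbabilityMeasure P]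

theorem iIndepFun_observation (h : RegressionModel P m X ε σ) :
    iIndepFun (observation m X ε) P :=
  (iIndepFun_prodMk_of_indepFun h.measurable_X h.measurable_ε h.iIndep_X h.iIndep_ε
    h.indep_X_ε).comp (fun _ e => (e.1, m e.1 + e.2)) fun _ => h.measurable_pair

theorem map_observation (h : RegressionModel P m X ε σ) (i : ℕ) :
    P.map (observation m X ε i) = P.map (observation m X ε 0) := by
  have hpair (k : ℕ) : P.map (fun ω => (X k ω, ε k ω)) = (P.map (X k)).prod (P.map (ε k)) :=
    (indepFun_iff_map_prod_eq_prod_map_map (h.measurable_X k).aemeasurable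
      (h.measurable_ε k).aemeasurable).1
      (h.indep_X_ε.comp (measurable_pi_apply k) (measurable_pi_apply k))
  have hmap (k : ℕ) : P.map (observation m X ε k) =
      ((P.map (X k)).prod (P.map (ε k))).map fun e => (e.1, m e.1 + e.2) := by
    rw [← hpair, Measure.map_map h.measurable_pair ((h.measurable_X k).prodMk (h.measurable_ε k))]
    rfl
  rw [hmap, hmap, (h.ident_X i).map_eq, (h.ident_ε i).map_eq]

theorem isProbabilityMeasure_map_observation (h : RegressionModel P m X ε σ) :
    IsProbabilityMeasure (P.map (observation m X ε 0)) :=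
  Measure.isProbabilityMeasure_map (h.measurable_observation 0).aemeasurable

theorem map_observationVector (h : RegressionModel P m X ε σ) (n : ℕ) :
    P.map (observationVector m X ε n) =
      Measure.pi fun _ : Option (Fin n) => P.map (observation m X ε 0) := by
  have hinj : Function.Injective fun o : Option (Fin n) => o.elim 0 fun i => (i : ℕ) + 1 := by
    rintro (_ | i) (_ | k) hik <;> simp_all [Fin.ext_iff]
  have h1 := (h.iIndepFun_observation.precomp hinj).map_fun_eq_pi_map
    fun o => (h.measurable_observation _).aemeasurable
  refine h1.trans ?_
  congr 1
  funext o
  exact h.map_observation _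

theorem memLp_regression (h : RegressionModel P m X ε σ)
    (hA1 : (P.map (X 0)).support = Set.Icc 0 1)
    (hA2 : BddAbove ((fun x => |m x|) '' Set.Icc 0 1)) (i : ℕ) :
    MemLp (fun ω => m (X i ω)) 2 P := by
  obtain ⟨C, hC⟩ := hA2
  have h0 : MemLp (fun ω => m (X 0 ω)) 2 P := by
    have := Measure.isProbabilityMeasure_map (μ := P) (h.measurable_X 0).aemeasurable
    refine MemLp.of_bound (h.measurable_m.comp (h.measurable_X 0)).aestronglyMeasurable C ?_
    have hs : ∀ᵐ x ∂(P.map (X 0)), x ∈ Set.Icc (0 : Fin p → ℝ) 1 :=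
      hA1 ▸ Measure.support_mem_ae
    filter_upwards [ae_of_ae_map (h.measurable_X 0).aemeasurable hs] with ω hω
    exact hC ⟨_, hω, rfl⟩
  exact ((h.ident_X i).comp h.measurable_m).symm.memLp_snd h0

variable {mtry : ℕ}

/-- The mean squared out-of-bag error of the infinite forest is controlled by its mean squared
generalization error. -/
theorem integral_sq_oob_error_le (h : RegressionModel P m X ε σ)
    (hmX : ∀ i, MemLp (fun ω => m (X i ω)) 2 P) (hmp : mtry ≤ p) {n a : ℕ} (ha : a < n) (T : ℕ)
    (i : Fin n) :
    ∫ ω, (treeAverage mtry (trainingData m X ε n ω) T (oobSubsamples n a i) (X (i + 1) ω)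
        - m (X (i + 1) ω)) ^ 2 ∂P ≤
      ((n : ℝ) / (n - a)) ^ 2 *
        ∫ ω, (treeAverage mtry (trainingData m X ε n ω) T (subsamples n a) (X 0 ω)
          - m (X 0 ω)) ^ 2 ∂P := by
  have hprob := h.isProbabilityMeasure_map_observation
  have hY : MemLp Prod.snd 2 (P.map (observation m X ε 0)) :=
    (memLp_map_measure_iff measurable_snd.aestronglyMeasurable
      (h.measurable_observation 0).aemeasurable).2 ((hmX 0).add (h.memLp_error 0))
  have hmL : MemLp (fun e : (Fin p → ℝ) × ℝ => m e.1) 2 (P.map (observation m X ε 0)) :=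
    (memLp_map_measure_iff (h.measurable_m.comp measurable_fst).aestronglyMeasurable
      (h.measurable_observation 0).aemeasurable).2 (hmX 0)
  have hmeas (Q : Finset (Finset (Fin n))) (o : Option (Fin n)) :
      Measurable fun z : Option (Fin n) → (Fin p → ℝ) × ℝ =>
        (treeAverage mtry (sampleOf z) T Q (z o).1 - m (z o).1) ^ 2 :=
    ((measurable_treeAverage measurable_sampleOf (by fun_prop) T _).sub
      (h.measurable_m.comp (by fun_prop))).pow_const 2
  have hle := integral_sq_oob_le (T := T) (ρ := P.map (observation m X ε 0)) hmp h.measurable_m hY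
    hmL ha i
  rw [← integral_sq_oob_eq h.measurable_m a i, ← h.map_observationVector n,
    integral_map (h.measurable_observationVector n).aemeasurable (hmeas _ _).aestronglyMeasurable,
    integral_map (h.measurable_observationVector n).aemeasurable
      (hmeas _ _).aestronglyMeasurable] at hle
  exact hle

end RegressionModel

end Model

/-! ## Consistency of the residual variance estimator -/

section Consistency

theorem measurable_sigmaSqWeighted {α : Type*} [MeasurableSpace α] {n p mtry : ℕ}
    {D : α → Sample n p} (hD : Measurable D) {θ : ℕ → α → TreeParam n p mtry}
    (hθ : ∀ k, Measurable (θ k)) (T : ℕ) (l : ℝ) (M : ℕ) :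
    Measurable fun q => sigmaSqWeighted (D q) T (fun k => θ k q) l M := by
  classical
  have hoob (i : Fin n) : Measurable fun q => oobPredict (D q) T (fun k => θ k q) M i := by
    have hcount : Measurable fun q =>
        (∑ k ∈ Finset.range M, if i ∉ (θ k q).sample then treePredict (D q) T (θ k q) (D q i).1
          else 0) / ∑ k ∈ Finset.range M, if i ∉ (θ k q).sample then (1 : ℝ) else 0 := by
      refine Measurable.div (Finset.measurable_sum _ fun k _ => ?_)
        (Finset.measurable_sum _ fun k _ => ?_)
      · have hx : Measurable fun q => (D q i).1 := by fun_prop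
        refine measurable_countable_index
          (g := fun t q => if i ∉ t.sample then treePredict (D q) T t (D q i).1 else 0) (hθ k)
          fun t => ?_
        by_cases ht : i ∉ t.sample
        · simpa only [if_pos ht] using measurable_treePredict hD hx T t
        · simpa only [if_neg ht] using measurable_const
      · exact measurable_countable_index
          (g := fun t _ => if i ∉ t.sample then (1 : ℝ) else 0) (hθ k) fun t => measurable_const
    refine (congrArg Measurable (funext fun q => ?_)).mp hcount
    rw [oobPredict, oobTrees, ← Finset.sum_filter, ← Finset.sum_filter, Finset.sum_const,
      nsmul_eq_mul, mul_one]
  have hsig : Measurable fun q => sigmaSqOOB (D q) T (fun k => θ k q) M :=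
    (Finset.measurable_sum _ fun i _ =>
      ((measurable_response hD i).sub (hoob i)).pow_const 2).div_const _
  have hcor : Measurable fun q => sigmaSqCorrected (D q) T (fun k => θ k q) M := by
    simp only [sigmaSqCorrected]
    exact (hsig.sub ((((Measurable.iSup fun i => (hoob i).abs).pow_const 2).add
      (hsig.mul_const _)).const_mul _)).abs
  exact (hcor.const_mul l).add (hsig.const_mul (1 - l))

variable {Ω : Type*} [MeasurableSpace Ω] {P : Measure Ω}

theorem aemeasurable_sigmaSqWeighted {n p mtry : ℕ} {D : Ω → Sample n p} (hD : Measurable D)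
    {θ : ℕ → Ω → TreeParam n p mtry} (hθ : ∀ k, AEMeasurable (θ k) P) (T : ℕ) (l : ℝ) (M : ℕ) :
    AEMeasurable (fun ω => sigmaSqWeighted (D ω) T (fun k => θ k ω) l M) P := by
  refine ⟨_, measurable_sigmaSqWeighted hD (fun k => (hθ k).measurable_mk) T l M, ?_⟩
  filter_upwards [ae_all_iff.2 fun k => (hθ k).ae_eq_mk] with ω hω
  simp only [hω]

theorem abs_limitSigmaSq_sub_le {n p mtry : ℕ} (D : Sample n p) (T a : ℕ) (e : Fin n → ℝ) (s : ℝ)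
    {η : ℝ} (hη : 0 < η) :
    |limitSigmaSq mtry D T a - s| ≤ |(∑ i, e i ^ 2) / (n : ℝ) - s| + η * ((∑ i, e i ^ 2) / (n : ℝ))
      + (η⁻¹ + 1) * ((∑ i, (treeAverage mtry D T (oobSubsamples n a i) (D i).1
          - ((D i).2 - e i)) ^ 2) / (n : ℝ)) := by
  set r : Fin n → ℝ := fun i => treeAverage mtry D T (oobSubsamples n a i) (D i).1
    - ((D i).2 - e i)
  have hpt (i : Fin n) : |2 * (e i * r i)| ≤ η * e i ^ 2 + η⁻¹ * r i ^ 2 := by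
    have h1 : 0 ≤ η⁻¹ * (η * e i - r i) ^ 2 := by positivity
    have h2 : 0 ≤ η⁻¹ * (η * e i + r i) ^ 2 := by positivity
    have h3 : η⁻¹ * η = 1 := inv_mul_cancel₀ hη.ne'
    have h4 : η⁻¹ * (η * e i - r i) ^ 2 = η * e i ^ 2 + η⁻¹ * r i ^ 2 - 2 * (e i * r i) := by
      field_simp; ring
    have h5 : η⁻¹ * (η * e i + r i) ^ 2 = η * e i ^ 2 + η⁻¹ * r i ^ 2 + 2 * (e i * r i) := by
      field_simp; ring
    rw [abs_le]
    constructor <;> linarith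
  have hexp : limitSigmaSq mtry D T a - s = ((∑ i, e i ^ 2) / (n : ℝ) - s)
      - (∑ i, 2 * (e i * r i)) / (n : ℝ) + (∑ i, r i ^ 2) / (n : ℝ) := by
    have hsum : ∑ i, ((D i).2 - treeAverage mtry D T (oobSubsamples n a i) (D i).1) ^ 2 =
        ∑ i, e i ^ 2 - ∑ i, 2 * (e i * r i) + ∑ i, r i ^ 2 := by
      rw [← Finset.sum_sub_distrib, ← Finset.sum_add_distrib]
      refine Finset.sum_congr rfl fun i _ => ?_
      simp only [r]
      ring
    rw [limitSigmaSq, hsum]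
    ring
  have hcross : |(∑ i, 2 * (e i * r i)) / (n : ℝ)| ≤
      η * ((∑ i, e i ^ 2) / (n : ℝ)) + η⁻¹ * ((∑ i, r i ^ 2) / (n : ℝ)) := by
    rw [abs_div, Nat.abs_cast, ← mul_div_assoc, ← mul_div_assoc, ← add_div]
    refine div_le_div_of_nonneg_right ?_ (Nat.cast_nonneg n)
    rw [Finset.mul_sum, Finset.mul_sum, ← Finset.sum_add_distrib]
    exact (Finset.abs_sum_le_sum_abs _ _).trans (Finset.sum_le_sum fun i _ => hpt i)
  have hr : 0 ≤ (∑ i, r i ^ 2) / (n : ℝ) :=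
    div_nonneg (Finset.sum_nonneg fun _ _ => sq_nonneg _) (Nat.cast_nonneg n)
  rw [hexp]
  refine (abs_add_le _ _).trans ?_
  rw [abs_of_nonneg hr]
  linarith [abs_sub ((∑ i, e i ^ 2) / (n : ℝ) - s) ((∑ i, 2 * (e i * r i)) / (n : ℝ))]

theorem integral_sq_eq_toReal_eLpNorm_sq {f : Ω → ℝ} (hf : MemLp f 2 P) :
    ∫ ω, f ω ^ 2 ∂P = (eLpNorm f 2 P).toReal ^ 2 := by
  have h0 : 0 ≤ ∫ ω, f ω ^ 2 ∂P := integral_nonneg fun ω => sq_nonneg _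
  rw [hf.eLpNorm_eq_integral_rpow_norm two_ne_zero ENNReal.ofNat_ne_top]
  simp only [ENNReal.toReal_ofNat, Real.rpow_two, Real.norm_eq_abs, sq_abs]
  rw [ENNReal.toReal_ofReal (by positivity), ← Real.rpow_natCast, ← Real.rpow_mul h0]
  simp

variable {p mtry : ℕ} {m : (Fin p → ℝ) → ℝ} {X : ℕ → Ω → Fin p → ℝ} {ε : ℕ → Ω → ℝ} {σ : ℝ}

theorem RegressionModel.integrable_sigmaSqWeighted (h : RegressionModel P m X ε σ)
    (hmX : ∀ i, MemLp (fun ω => m (X i ω)) 2 P) {n : ℕ} {θ : ℕ → Ω → TreeParam n p mtry}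
    (hθ : ∀ k, AEMeasurable (θ k) P) (T : ℕ) {l : ℝ} (hl : l ∈ Set.Ioo (0 : ℝ) 1) (M : ℕ) :
    Integrable (fun ω => sigmaSqWeighted (trainingData m X ε n ω) T (fun k => θ k ω) l M) P :=
  ((h.memLp_absResponseSum hmX n).integrable_sq.const_mul (44 + 128 * Real.log n)).mono'
    (aemeasurable_sigmaSqWeighted (h.measurable_trainingData n) hθ T l M).aestronglyMeasurable
    (ae_of_all _ fun _ => abs_sigmaSqWeighted_le _ T _ M hl)

variable [IsProbabilityMeasure P]

/-- A bound on the risk of the residual variance estimator of the infinite forest by the law of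
large numbers for the squared errors and the generalization error of the infinite forest. -/
theorem RegressionModel.integral_abs_limitSigmaSq_sub_le (h : RegressionModel P m X ε σ)
    (hmX : ∀ i, MemLp (fun ω => m (X i ω)) 2 P) (hmp : mtry ≤ p) {n a : ℕ} (ha : a < n) (T : ℕ)
    {η w : ℝ} (hη : 0 < η)
    (hw : ((n : ℝ) / (n - a)) ^ 2 *
      ∫ ω, (treeAverage mtry (trainingData m X ε n ω) T (subsamples n a) (X 0 ω)
        - m (X 0 ω)) ^ 2 ∂P ≤ w) :
    ∫ ω, |limitSigmaSq mtry (trainingData m X ε n ω) T a - σ ^ 2| ∂P ≤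
      ∫ ω, |(∑ i : Fin n, ε (i + 1) ω ^ 2) / (n : ℝ) - σ ^ 2| ∂P + η * σ ^ 2
        + (η⁻¹ + 1) * w := by
  have hn : (n : ℝ) ≠ 0 := by
    have : n ≠ 0 := by omega
    exact_mod_cast this
  set r : Fin n → Ω → ℝ := fun i ω =>
    treeAverage mtry (trainingData m X ε n ω) T (oobSubsamples n a i) (X (i + 1) ω)
      - m (X (i + 1) ω)
  have hr (i : Fin n) : Integrable (fun ω => r i ω ^ 2) P := by
    refine (MemLp.sub ?_ (hmX (i + 1))).integrable_sq
    refine (h.memLp_absResponseSum hmX n).mono' (measurable_treeAverage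
      (h.measurable_trainingData n) (h.measurable_X _) T _).aestronglyMeasurable
      (ae_of_all _ fun ω => abs_treeAverage_le _ T _ _)
  have he (i : Fin n) : Integrable (fun ω => ε (i + 1) ω ^ 2) P := (h.memLp_error _).integrable_sq
  have hE : Integrable (fun ω => (∑ i : Fin n, ε (i + 1) ω ^ 2) / (n : ℝ)) P :=
    (integrable_finsetSum _ fun i _ => he i).div_const _
  have hR : Integrable (fun ω => (∑ i, r i ω ^ 2) / (n : ℝ)) P :=
    (integrable_finsetSum _ fun i _ => hr i).div_const _
  have hE' : ∫ ω, (∑ i : Fin n, ε (i + 1) ω ^ 2) / (n : ℝ) ∂P = σ ^ 2 := by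
    rw [integral_div, integral_finsetSum _ fun i _ => he i]
    simp only [h.integral_error_sq, Finset.sum_const, Finset.card_univ, Fintype.card_fin,
      nsmul_eq_mul]
    field_simp
  have hR' : ∫ ω, (∑ i, r i ω ^ 2) / (n : ℝ) ∂P ≤ w := by
    rw [integral_div, integral_finsetSum _ fun i _ => hr i, div_le_iff₀ (by positivity)]
    calc ∑ i, ∫ ω, r i ω ^ 2 ∂P ≤ ∑ _i : Fin n, w :=
          Finset.sum_le_sum fun i _ => (h.integral_sq_oob_error_le hmX hmp ha T i).trans hw
      _ = w * n := by simp [mul_comm]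
  have hEs : Integrable (fun ω => |(∑ i : Fin n, ε (i + 1) ω ^ 2) / (n : ℝ) - σ ^ 2|) P :=
    (hE.sub (integrable_const _)).abs
  calc ∫ ω, |limitSigmaSq mtry (trainingData m X ε n ω) T a - σ ^ 2| ∂P
      ≤ ∫ ω, (|(∑ i : Fin n, ε (i + 1) ω ^ 2) / (n : ℝ) - σ ^ 2|
          + η * ((∑ i : Fin n, ε (i + 1) ω ^ 2) / (n : ℝ))
          + (η⁻¹ + 1) * ((∑ i, r i ω ^ 2) / (n : ℝ))) ∂P := by
        refine integral_mono_of_nonneg (ae_of_all _ fun ω => abs_nonneg _)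
          ((hEs.add (hE.const_mul η)).add (hR.const_mul _)) (ae_of_all _ fun ω => ?_)
        have := abs_limitSigmaSq_sub_le (mtry := mtry) (trainingData m X ε n ω) T a
          (fun i => ε (i + 1) ω) (σ ^ 2) hη
        simpa only [trainingData, add_sub_cancel_right] using this
    _ = ∫ ω, |(∑ i : Fin n, ε (i + 1) ω ^ 2) / (n : ℝ) - σ ^ 2| ∂P + η * σ ^ 2
          + (η⁻¹ + 1) * ∫ ω, (∑ i, r i ω ^ 2) / (n : ℝ) ∂P := by
        have hEη : Integrable (fun ω => |(∑ i : Fin n, ε (i + 1) ω ^ 2) / (n : ℝ) - σ ^ 2|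
            + η * ((∑ i : Fin n, ε (i + 1) ω ^ 2) / (n : ℝ))) P := hEs.add (hE.const_mul η)
        rw [integral_add hEη (hR.const_mul _),
          integral_add hEs (hE.const_mul η), integral_const_mul, integral_const_mul, hE']
    _ ≤ _ := by gcongr

theorem RegressionModel.tendsto_integral_sigmaSqWeighted (h : RegressionModel P m X ε σ)
    (hmX : ∀ i, MemLp (fun ω => m (X i ω)) 2 P) {n a : ℕ} {θ : ℕ → Ω → TreeParam n p mtry}
    (hlaw : ∀ k, HasLaw (θ k) (uniformOn {t : TreeParam n p mtry | t.sample.card = a}) P)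
    (hind : iIndepFun θ P) (T : ℕ) {l : ℝ} (hl : l ∈ Set.Ioo (0 : ℝ) 1) :
    Tendsto (fun M : ℕ => ∫ ω,
        |sigmaSqWeighted (trainingData m X ε n ω) T (fun k => θ k ω) l M - σ ^ 2| ∂P) atTop
      (𝓝 (∫ ω, |limitSigmaSq mtry (trainingData m X ε n ω) T a - σ ^ 2| ∂P)) := by
  have hint := fun M =>
    h.integrable_sigmaSqWeighted hmX (fun k => (hlaw k).aemeasurable) T hl M
  refine tendsto_integral_of_dominated_convergence (fun ω =>
    (44 + 128 * Real.log n) * absResponseSum (trainingData m X ε n ω) ^ 2 + σ ^ 2)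
    (fun M => ((hint M).sub (integrable_const _)).abs.aestronglyMeasurable)
    (((h.memLp_absResponseSum hmX n).integrable_sq.const_mul _).add (integrable_const _))
    (fun M => ae_of_all _ fun ω => ?_) ?_
  · rw [Real.norm_eq_abs, abs_abs]
    refine (abs_sub _ _).trans (add_le_add (abs_sigmaSqWeighted_le _ T _ M hl) ?_)
    rw [abs_of_nonneg (sq_nonneg σ)]
  · filter_upwards [ae_tendsto_average hlaw hind, ae_card_sample_eq hlaw] with ω hω hcard
    exact ((tendsto_sigmaSqWeighted
      (tendsto_sigmaSqOOB fun i => tendsto_oobPredict hω hcard i) l).sub_const _).abs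

end Consistency

end

theorem mainTheorem2 {Ω : Type*} [MeasurableSpace Ω] (P : Measure Ω) [IsProbabilityMeasure P]
    (p mtry : ℕ) (hmtry : 1 ≤ mtry) (hmtry' : mtry ≤ p)
    (a T : ℕ → ℕ) (ha : ∀ n, 1 ≤ n → 1 ≤ a n ∧ a n ≤ n) (hT : ∀ n, 1 ≤ T n)
    (hoob : ∃ c : ℝ, c < 1 ∧ ∀ᶠ n : ℕ in atTop, (a n : ℝ) ≤ c * n)
    (m : (Fin p → ℝ) → ℝ) (X : ℕ → Ω → Fin p → ℝ) (ε : ℕ → Ω → ℝ) (σ : ℝ)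
    (hmodel : RegressionModel P m X ε σ)
    (Θ : ∀ n : ℕ, ℕ → Ω → TreeParam n p mtry)
    (hforest : ForestRandomness P X ε a Θ)
    (hA1 : (P.map (X 0)).support = Set.Icc 0 1)
    (hA2 : BddAbove ((fun x => |m x|) '' Set.Icc 0 1))
    (hA3 : ∀ i, HasLaw (ε i) (gaussianReal 0 (σ ^ 2).toNNReal) P)
    (hA4 : Tendsto (fun n : ℕ => eLpNorm (fun ω =>
      infForestPredict (trainingData m X ε n ω) (T n) (fun k => Θ n k ω) (X 0 ω) - m (X 0 ω)) 2 P)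
      atTop (𝓝 0))
    (l : ℝ) (hl : l ∈ Set.Ioo (0 : ℝ) 1) :
    (∀ n M : ℕ, 1 ≤ n → 1 ≤ M → Integrable (fun ω =>
      sigmaSqWeighted (trainingData m X ε n ω) (T n) (fun k => Θ n k ω) l M) P) ∧
    ∃ L : ℕ → ℝ,
      (∀ n : ℕ, 1 ≤ n → Tendsto (fun M : ℕ => ∫ ω,
        |sigmaSqWeighted (trainingData m X ε n ω) (T n) (fun k => Θ n k ω) l M - σ ^ 2| ∂P)
        atTop (𝓝 (L n))) ∧
      Tendsto L atTop (𝓝 0) := by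
  have hmX := hmodel.memLp_regression hA1 hA2
  have hΘ (n : ℕ) (hn : 1 ≤ n) (k : ℕ) : AEMeasurable (Θ n k) P :=
    (hforest.law n hn k).aemeasurable
  refine ⟨fun n M hn _ => hmodel.integrable_sigmaSqWeighted hmX (hΘ n hn) (T n) hl M,
    fun n => ∫ ω, |limitSigmaSq mtry (trainingData m X ε n ω) (T n) (a n) - σ ^ 2| ∂P,
    fun n hn => hmodel.tendsto_integral_sigmaSqWeighted hmX (hforest.law n hn)
      (hforest.iIndep n hn) (T n) hl, ?_⟩
  obtain ⟨c, hc, hac⟩ := hoob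
  set f : ∀ n : ℕ, Ω → ℝ := fun n ω =>
    treeAverage mtry (trainingData m X ε n ω) (T n) (subsamples n (a n)) (X 0 ω) - m (X 0 ω)
  have hf (n : ℕ) : MemLp (f n) 2 P := by
    refine MemLp.sub ?_ (hmX 0)
    exact (hmodel.memLp_absResponseSum hmX n).mono' (measurable_treeAverage
      (hmodel.measurable_trainingData n) (hmodel.measurable_X _) _ _).aestronglyMeasurable
      (ae_of_all _ fun ω => abs_treeAverage_le _ _ _ _)
  have hu : Tendsto (fun n => ∫ ω, f n ω ^ 2 ∂P) atTop (𝓝 0) := by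
    have hlim := ((ENNReal.tendsto_toReal ENNReal.zero_ne_top).comp hA4).pow 2
    rw [ENNReal.toReal_zero, zero_pow two_ne_zero] at hlim
    refine hlim.congr' ?_
    filter_upwards [eventually_ge_atTop 1] with n hn
    rw [integral_sq_eq_toReal_eLpNorm_sq (hf n), Function.comp_apply]
    congr 2
    refine eLpNorm_congr_ae ?_
    filter_upwards [ae_tendsto_average (hforest.law n hn) (hforest.iIndep n hn)] with ω hω
    simp only [f, infForestPredict_eq hω]
  set w : ℕ → ℝ := fun n => (1 / (1 - c)) ^ 2 * ∫ ω, f n ω ^ 2 ∂P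
  have hw0 (n : ℕ) : 0 ≤ w n :=
    mul_nonneg (sq_nonneg _) (integral_nonneg fun ω => sq_nonneg _)
  have hw : Tendsto w atTop (𝓝 0) := by
    have h := hu.const_mul ((1 / (1 - c)) ^ 2)
    rwa [mul_zero] at h
  have hsw : Tendsto (fun n => √(w n)) atTop (𝓝 0) := by simpa using hw.sqrt
  have hη : Tendsto (fun n : ℕ => √(w n) + 1 / ((n : ℝ) + 1)) atTop (𝓝 0) := by
    simpa using hsw.add tendsto_one_div_add_atTop_nhds_zero_nat
  have hbound := ((hmodel.tendsto_integral_mean_sq_error.add (hη.mul_const (σ ^ 2))).add hsw).add hw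
  simp only [zero_mul, add_zero] at hbound
  refine tendsto_of_tendsto_of_tendsto_of_le_of_le' tendsto_const_nhds hbound
    (Eventually.of_forall fun n => integral_nonneg fun ω => abs_nonneg _) ?_
  filter_upwards [hac, eventually_ge_atTop 1] with n hacn hn
  have hn0 : (0 : ℝ) < n := by exact_mod_cast hn
  have hc' : 0 < 1 - c := sub_pos.2 hc
  have hna : (1 - c) * n ≤ n - a n := by linarith
  have hna0 : (0 : ℝ) < n - a n := (mul_pos hc' hn0).trans_le hna
  have han : a n < n := by exact_mod_cast sub_pos.1 hna0
  have hratio : (n : ℝ) / (n - a n) ≤ 1 / (1 - c) := by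
    rw [div_le_div_iff₀ hna0 hc']
    linarith
  have hη0 : 0 < √(w n) + 1 / ((n : ℝ) + 1) := by positivity
  have hle := hmodel.integral_abs_limitSigmaSq_sub_le hmX hmtry' han (T n) hη0 (w := w n) (by
    refine mul_le_mul_of_nonneg_right ?_ (integral_nonneg fun ω => sq_nonneg _)
    gcongr)
  have hinv : (√(w n) + 1 / ((n : ℝ) + 1))⁻¹ * w n ≤ √(w n) := by
    rw [inv_mul_le_iff₀ hη0]
    nlinarith [Real.mul_self_sqrt (hw0 n), Real.sqrt_nonneg (w n),
      mul_nonneg (by positivity : (0 : ℝ) ≤ 1 / ((n : ℝ) + 1)) (Real.sqrt_nonneg (w n))]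
  refine hle.trans ?_
  rw [add_one_mul (_⁻¹ : ℝ)]
  linarith
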